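/- Let $d\ge 1$ be an integer and let $c\in C([0,1])$. For an interval $(a,b)\subseteq(0,1)$, a continuous function $v$ on $(a,b)$ and a Dirichlet or Neumann condition prescribed at each endpoint, the principal eigenvalue of $$-\varphi''-\tfrac{d-1}{r}\varphi'-v\varphi'+c\varphi=\lambda\varphi\quad\text{on }(a,b)$$ is the real number $\lambda$ for which this problem has a solution $\varphi\in C^1([a,b])\cap C^2((a,b))$ with $\varphi>0$ on $(a,b)$ that satisfies the boundary conditions. Let $\lambda^{\mathcal{DD}}$ and $\lambda^{\mathcal{NN}}$ be the principal eigenvalues with $v=0$ on $(\tfrac13,\tfrac23)$ under Dirichlet conditions $\varphi(\tfrac13)=\varphi(\tfrac23)=0$ and under Neumann conditions $\varphi'(\tfrac13)=\varphi'(\tfrac23)=0$, respectively. For $m\in C^1([0,1])$ and $s\in\mathbb{R}$ let $\lambda(s,m)$ be the principal eigenvalue with $v=2sm'$ on $(0,1)$ under the conditions $\varphi'(0)=\varphi'(1)=0$; this is the radial Neumann problem for $-\Delta\varphi-2s\nabla m\cdot\nabla\varphi+c\varphi=\lambda\varphi$ on the unit ball of $\mathbb{R}^d$. Assume $$\text{(H1)}\qquad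 c(r)>\lambda^{\mathcal{DD}}\quad\text{for all } r\in[0,\tfrac13]\cup[\tfrac23,1].$$ Then $\lambda^{\mathcal{NN}}$ exists and is unique, and there is a function $m\in C^1([0,1])$ with $m=0$ on $[\tfrac13,\tfrac23]$ and $m(r)=m(1-r)$ for all $r\in[0,1]$, which is infinitely oscillating in the sense that it takes both positive and negative values in every left neighbourhood of $\tfrac13$ and in every right neighbourhood of $\tfrac23$, such that $\lambda(s,m)$ exists and is unique for every $s\in\mathbb{R}$ and does not converge to a real number as $s\to+\infty$. Moreover there are sequences $s_n\to+\infty$ and $s_n'\to+\infty$ with $$\lim_{n\to\infty}\lambda(s_n,m)=\lambda^{\mathcal{DD}},\qquad \lim_{n\to\infty}\lambda(s_n',m)=\lambda^{\mathcal{NN}}.$$ -/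

import Mathlib

open Set Filter Topology

/-- The two types of boundary condition. -/
inductive BoundaryType
  | dirichlet
  | neumann

/-- The boundary condition of the given type for a function `φ` on `[a, b]` at an endpoint `e`
(a one-sided derivative in the Neumann case). -/
def BoundaryType.Holds (B : BoundaryType) (a b : ℝ) (φ : ℝ → ℝ) (e : ℝ) : Prop :=
  match B with
  | .dirichlet => φ e = 0
  | .neumann => derivWithin φ (Icc a b) e = 0

/-- `φ` is a positive (classical) eigenfunction for the eigenvalue `μ` of
`-φ'' - ((d - 1) / r) φ' - v φ' + c φ = μ φ` on `(a, b)`,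
with boundary condition `A` at `a` and `B` at `b`. -/
structure IsPositiveEigenfunction (d : ℕ) (v c : ℝ → ℝ) (a b : ℝ) (A B : BoundaryType)
    (μ : ℝ) (φ : ℝ → ℝ) : Prop where
  contDiffOn_closed : ContDiffOn ℝ 1 φ (Icc a b)
  contDiffOn_open : ContDiffOn ℝ 2 φ (Ioo a b)
  equation : ∀ r ∈ Ioo a b,
    -deriv (deriv φ) r - (((d : ℝ) - 1) / r) * deriv φ r - v r * deriv φ r + c r * φ r = μ * φ r
  left : A.Holds a b φ a
  right : B.Holds a b φ b
  pos : ∀ r ∈ Ioo a b, 0 < φ r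

/-- `μ` is the principal eigenvalue, that is, the eigenvalue with a positive eigenfunction. -/
def IsPrincipalEigenvalue (d : ℕ) (v c : ℝ → ℝ) (a b : ℝ) (A B : BoundaryType) (μ : ℝ) : Prop :=
  ∃ φ : ℝ → ℝ, IsPositiveEigenfunction d v c a b A B μ φ

/-- `μ` is the eigenvalue `λ^{AB}`: principal eigenvalue without advection on `(1/3, 2/3)`. -/
def IsMiddleEigenvalue (d : ℕ) (c : ℝ → ℝ) (A B : BoundaryType) (μ : ℝ) : Prop :=
  IsPrincipalEigenvalue d (fun _ => 0) c (1 / 3) (2 / 3) A B μ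

/-- `μ` is the eigenvalue `λ(s, m)`: principal eigenvalue of the radial Neumann problem on the
unit ball of dimension `d` with advection `2 s ∇m`. -/
def IsBallEigenvalue (d : ℕ) (c m : ℝ → ℝ) (s μ : ℝ) : Prop :=
  IsPrincipalEigenvalue d (fun r => 2 * s * deriv m r) c 0 1 .neumann .neumann μ

/-- `m` changes sign infinitely often along the filter `l` (used for one-sided neighbourhoods of
a point): it takes positive and negative values arbitrarily far along `l`. -/
def OscillatesInfinitely (m : ℝ → ℝ) (l : Filter ℝ) : Prop :=
  (∃ᶠ r in l, 0 < m r) ∧ (∃ᶠ r in l, m r < 0)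

/-!
In divergence form the equation is `(p φ')' = p (c - λ) φ` with `p = r ^ (d - 1) * e ^ (2 s m)`.
Green's identity for the Wronskian of two solutions orders principal eigenvalues by their boundary
data, and shows that `λ(s, m)` lies between `λ^{NN}` and `λ^{DD}`. By (H1) the coefficient `c - λ`
is then positive outside the middle interval, so `φ` increases on `[0, 1/3]` and decreases on
`[2/3, 1]`; everything is decided by the size of `φ' / φ` at `1/3` and, by reflection, at `2/3`.

Near `1/3` the potential `m` has peaks and troughs of height `x ^ 2` at arbitrarily small scales
`x`, and between such an extremum and `1/3` the opposite sign reaches at most the size `x ^ 4`. Take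
`s = x ^ (-4)`. At a peak the weight is at least of order `x ^ (-2)` on an interval of length of
order `x`, and of order one up to `1/3`: the growth of the flux `p φ'` over that interval makes
`φ' / φ` at least of order `1 / x`, so the middle problem is nearly a Dirichlet problem. At a trough
the weight is at most of order `x ^ 2` on such an interval, which a flux can cross only by being
small: `φ' / φ` is at most of order `x`, and the middle problem is nearly a Neumann problem.

Existence is a shooting argument: the solution with `φ = 1` and `φ' = 0` at the left endpoint is the
fixed point of a Volterra operator, also where the weight vanishes at the origin.
-/

/-- `φ` solves the divergence-form equation `(p φ')' = p g` on `[a, b]`, with derivative `φ₁`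
continuous up to the boundary. The equation is asked for in the interior only, because the weight
`p` of a radial problem vanishes at the origin. -/
structure IsFluxSolution (p g : ℝ → ℝ) (a b : ℝ) (φ φ₁ : ℝ → ℝ) : Prop where
  hasDerivWithinAt : ∀ r ∈ Icc a b, HasDerivWithinAt φ (φ₁ r) (Icc a b) r
  continuousOn_deriv : ContinuousOn φ₁ (Icc a b)
  hasDerivAt_flux : ∀ r ∈ Ioo a b, HasDerivAt (fun t => p t * φ₁ t) (p r * g r) r

/-- The Wronskian of `φ` and `u`, whose derivatives are `φ₁` and `u₁`, for the weight `p`. -/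
def wronskian (p φ φ₁ u u₁ : ℝ → ℝ) (r : ℝ) : ℝ := p r * φ₁ r * u r - φ r * (p r * u₁ r)

theorem nonneg_on_Icc_of_pos_on_Ioo {f : ℝ → ℝ} {a b : ℝ} (hab : a < b)
    (hf : ContinuousOn f (Icc a b)) (hpos : ∀ r ∈ Ioo a b, 0 < f r) {r : ℝ} (hr : r ∈ Icc a b) :
    0 ≤ f r := by
  rw [← closure_Ioo hab.ne] at hf hr
  exact le_on_closure (fun t ht => (hpos t ht).le) continuousOn_const hf hr

theorem left_le_right_of_deriv_nonneg {f f' : ℝ → ℝ} {a b : ℝ} (hab : a ≤ b)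
    (hf : ContinuousOn f (Icc a b)) (hf' : ∀ r ∈ Ioo a b, HasDerivAt f (f' r) r)
    (hnonneg : ∀ r ∈ Ioo a b, 0 ≤ f' r) : f a ≤ f b :=
  monotoneOn_of_hasDerivWithinAt_nonneg (convex_Icc a b) hf
    (fun r hr => (hf' r (interior_Icc.subset hr)).hasDerivWithinAt)
    (fun r hr => hnonneg r (interior_Icc.subset hr))
    (left_mem_Icc.2 hab) (right_mem_Icc.2 hab) hab

theorem left_lt_right_of_deriv_pos {f f' : ℝ → ℝ} {a b : ℝ} (hab : a < b)
    (hf : ContinuousOn f (Icc a b)) (hf' : ∀ r ∈ Ioo a b, HasDerivAt f (f' r) r)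
    (hpos : ∀ r ∈ Ioo a b, 0 < f' r) : f a < f b :=
  strictMonoOn_of_hasDerivWithinAt_pos (convex_Icc a b) hf
    (fun r hr => (hf' r (interior_Icc.subset hr)).hasDerivWithinAt)
    (fun r hr => hpos r (interior_Icc.subset hr))
    (left_mem_Icc.2 hab.le) (right_mem_Icc.2 hab.le) hab

namespace IsFluxSolution

variable {p g h k φ φ₁ u u₁ : ℝ → ℝ} {a b a' b' : ℝ}

theorem hasDerivAt (H : IsFluxSolution p g a b φ φ₁) {r : ℝ} (hr : r ∈ Ioo a b) :
    HasDerivAt φ (φ₁ r) r :=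
  (H.hasDerivWithinAt r (Ioo_subset_Icc_self hr)).hasDerivAt (Icc_mem_nhds hr.1 hr.2)

theorem continuousOn (H : IsFluxSolution p g a b φ φ₁) : ContinuousOn φ (Icc a b) :=
  fun r hr => (H.hasDerivWithinAt r hr).continuousWithinAt

theorem continuousOn_flux (H : IsFluxSolution p g a b φ φ₁) (hp : ContinuousOn p (Icc a b)) :
    ContinuousOn (fun t => p t * φ₁ t) (Icc a b) :=
  hp.mul H.continuousOn_deriv

theorem mono (H : IsFluxSolution p g a b φ φ₁) (ha : a ≤ a') (hb : b' ≤ b) :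
    IsFluxSolution p g a' b' φ φ₁ where
  hasDerivWithinAt r hr :=
    (H.hasDerivWithinAt r (Icc_subset_Icc ha hb hr)).mono (Icc_subset_Icc ha hb)
  continuousOn_deriv := H.continuousOn_deriv.mono (Icc_subset_Icc ha hb)
  hasDerivAt_flux r hr := H.hasDerivAt_flux r (Ioo_subset_Ioo ha hb hr)

theorem congr {q : ℝ → ℝ} (H : IsFluxSolution p g a b φ φ₁) (hpq : ∀ r ∈ Ioo a b, q r = p r)
    (hgh : ∀ r ∈ Ioo a b, h r = g r) : IsFluxSolution q h a b φ φ₁ where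
  hasDerivWithinAt := H.hasDerivWithinAt
  continuousOn_deriv := H.continuousOn_deriv
  hasDerivAt_flux r hr := by
    rw [hpq r hr, hgh r hr]
    refine (H.hasDerivAt_flux r hr).congr_of_eventuallyEq ?_
    filter_upwards [Ioo_mem_nhds hr.1 hr.2] with t ht
    rw [hpq t ht]

theorem reflect (H : IsFluxSolution p g a b φ φ₁) (s : ℝ) :
    IsFluxSolution (fun r => p (s - r)) (fun r => g (s - r)) (s - b) (s - a)
      (fun r => φ (s - r)) (fun r => -φ₁ (s - r)) := by
  have hmaps : MapsTo (fun r => s - r) (Icc (s - b) (s - a)) (Icc a b) :=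
    fun r hr => ⟨by linarith [hr.2], by linarith [hr.1]⟩
  refine ⟨fun r hr => ?_, ?_, fun r hr => ?_⟩
  · simpa [Function.comp_def] using (H.hasDerivWithinAt (s - r) (hmaps hr)).comp r
      ((hasDerivWithinAt_id r _).const_sub s) hmaps
  · exact (H.continuousOn_deriv.comp (f := fun r => s - r) (by fun_prop) hmaps).neg
  · simpa [Function.comp_def] using ((H.hasDerivAt_flux (s - r)
      ⟨by linarith [hr.2], by linarith [hr.1]⟩).comp r ((hasDerivAt_id r).const_sub s)).fun_neg

theorem const_mul (H : IsFluxSolution p g a b φ φ₁) (x : ℝ) :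
    IsFluxSolution p (fun r => x * g r) a b (fun r => x * φ r) (fun r => x * φ₁ r) where
  hasDerivWithinAt r hr := (H.hasDerivWithinAt r hr).const_mul x
  continuousOn_deriv := continuousOn_const.mul H.continuousOn_deriv
  hasDerivAt_flux r hr := by
    simpa only [mul_left_comm] using (H.hasDerivAt_flux r hr).const_mul x

theorem add (H : IsFluxSolution p g a b φ φ₁) (Hu : IsFluxSolution p h a b u u₁) :
    IsFluxSolution p (fun r => g r + h r) a b (fun r => φ r + u r) (fun r => φ₁ r + u₁ r) where
  hasDerivWithinAt r hr := (H.hasDerivWithinAt r hr).add (Hu.hasDerivWithinAt r hr)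
  continuousOn_deriv := H.continuousOn_deriv.add Hu.continuousOn_deriv
  hasDerivAt_flux r hr := by
    simpa only [mul_add] using (H.hasDerivAt_flux r hr).fun_add (Hu.hasDerivAt_flux r hr)

theorem const (x : ℝ) : IsFluxSolution p (fun _ => 0) a b (fun _ => x) (fun _ => 0) where
  hasDerivWithinAt r _ := hasDerivWithinAt_const r _ x
  continuousOn_deriv := continuousOn_const
  hasDerivAt_flux r _ := by simpa using hasDerivAt_const r (0 : ℝ)

theorem continuousOn_wronskian (H : IsFluxSolution p g a b φ φ₁)
    (Hu : IsFluxSolution p h a b u u₁) (hp : ContinuousOn p (Icc a b)) :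
    ContinuousOn (wronskian p φ φ₁ u u₁) (Icc a b) :=
  ((H.continuousOn_flux hp).mul Hu.continuousOn).sub
    (H.continuousOn.mul (Hu.continuousOn_flux hp))

theorem hasDerivAt_wronskian (H : IsFluxSolution p g a b φ φ₁)
    (Hu : IsFluxSolution p h a b u u₁) {r : ℝ} (hr : r ∈ Ioo a b) :
    HasDerivAt (wronskian p φ φ₁ u u₁) (p r * (g r * u r - φ r * h r)) r :=
  (((H.hasDerivAt_flux r hr).mul (Hu.hasDerivAt hr)).sub
    ((H.hasDerivAt hr).mul (Hu.hasDerivAt_flux r hr))).congr_deriv (by ring)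

theorem wronskian_lt (H : IsFluxSolution p g a b φ φ₁) (Hu : IsFluxSolution p h a b u u₁)
    (hab : a < b) (hp : ContinuousOn p (Icc a b)) (hppos : ∀ r ∈ Ioo a b, 0 < p r)
    (hlt : ∀ r ∈ Ioo a b, φ r * h r < g r * u r) :
    wronskian p φ φ₁ u u₁ a < wronskian p φ φ₁ u u₁ b :=
  left_lt_right_of_deriv_pos hab (H.continuousOn_wronskian Hu hp)
    (fun _ hr => H.hasDerivAt_wronskian Hu hr)
    fun r hr => mul_pos (hppos r hr) (sub_pos.2 (hlt r hr))

theorem flux_le (H : IsFluxSolution p g a b φ φ₁) (hab : a ≤ b) (hp : ContinuousOn p (Icc a b))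
    (hpos : ∀ r ∈ Ioo a b, 0 ≤ p r * g r) : p a * φ₁ a ≤ p b * φ₁ b :=
  left_le_right_of_deriv_nonneg hab (H.continuousOn_flux hp) H.hasDerivAt_flux hpos

theorem flux_lt (H : IsFluxSolution p g a b φ φ₁) (hab : a < b) (hp : ContinuousOn p (Icc a b))
    (hppos : ∀ r ∈ Ioo a b, 0 < p r) (hg : ∀ r ∈ Ioo a b, 0 < g r) :
    p a * φ₁ a < p b * φ₁ b :=
  left_lt_right_of_deriv_pos hab (H.continuousOn_flux hp) H.hasDerivAt_flux
    fun r hr => mul_pos (hppos r hr) (hg r hr)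

theorem eq_zero_of_right (H : IsFluxSolution p (fun r => k r * φ r) a b φ φ₁)
    (hp : ContinuousOn p (Icc a b)) (hppos : ∀ r ∈ Icc a b, 0 < p r)
    (hk : ContinuousOn k (Icc a b)) (hb : φ b = 0) (hb₁ : φ₁ b = 0) {r : ℝ} (hr : r ∈ Icc a b) :
    φ r = 0 := by
  obtain ⟨C, hC⟩ := isCompact_Icc.exists_bound_of_continuousOn
    ((hp.inv₀ fun r hr => (hppos r hr).ne').add (hp.mul hk))
  have hsub : Icc r b ⊆ Icc a b := Icc_subset_Icc_left hr.1
  -- The energy `φ² + (p φ')²` grows at most exponentially, also towards the left.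
  have henergy : (φ r ^ 2 + (p r * φ₁ r) ^ 2) * Real.exp (C * r) ≤
      (φ b ^ 2 + (p b * φ₁ b) ^ 2) * Real.exp (C * b) := by
    refine left_le_right_of_deriv_nonneg hr.2
      (f := fun t => (φ t ^ 2 + (p t * φ₁ t) ^ 2) * Real.exp (C * t))
      (((H.continuousOn.pow 2).add ((H.continuousOn_flux hp).pow 2)).mono hsub |>.mul
        (by fun_prop))
      (fun t ht => ((((H.mono hr.1 le_rfl).hasDerivAt ht).pow 2).add
        (((H.mono hr.1 le_rfl).hasDerivAt_flux t ht).pow 2)).mul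
        ((hasDerivAt_id t).const_mul C).exp) fun t ht => ?_
    have htm := hsub (Ioo_subset_Icc_self ht)
    obtain ⟨hC₁, hC₂⟩ : -C ≤ (p t)⁻¹ + p t * k t ∧ (p t)⁻¹ + p t * k t ≤ C :=
      abs_le.1 (hC t htm)
    have hsplit : φ t * φ₁ t = (p t)⁻¹ * (φ t * (p t * φ₁ t)) := by
      field_simp [(hppos t htm).ne']
    have hrate : 0 ≤ 2 * ((p t)⁻¹ + p t * k t) * (φ t * (p t * φ₁ t)) +
        C * (φ t ^ 2 + (p t * φ₁ t) ^ 2) := by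
      nlinarith [mul_nonneg (neg_le_iff_add_nonneg.1 hC₁) (sq_nonneg (φ t + p t * φ₁ t)),
        mul_nonneg (sub_nonneg.2 hC₂) (sq_nonneg (φ t - p t * φ₁ t))]
    refine (mul_nonneg hrate (Real.exp_pos (C * t)).le).trans_eq ?_
    simp only [id, Pi.add_apply, Pi.pow_apply]
    push_cast
    linear_combination (-2 * Real.exp (C * t)) * hsplit
  rw [hb, hb₁, mul_zero, zero_pow two_ne_zero, add_zero, zero_mul] at henergy
  have := nonpos_of_mul_nonpos_left henergy (Real.exp_pos _)
  exact pow_eq_zero_iff two_ne_zero |>.1 (by linarith [sq_nonneg (φ r), sq_nonneg (p r * φ₁ r)])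

theorem neumann_le {c ψ ψ₁ : ℝ → ℝ} {μ ν : ℝ}
    (H : IsFluxSolution p (fun r => (c r - μ) * φ r) a b φ φ₁)
    (Hψ : IsFluxSolution p (fun r => (c r - ν) * ψ r) a b ψ ψ₁) (hab : a < b)
    (hp : ContinuousOn p (Icc a b)) (hppos : ∀ r ∈ Ioo a b, 0 < p r)
    (hφ : ∀ r ∈ Ioo a b, 0 < φ r) (hψ : ∀ r ∈ Ioo a b, 0 < ψ r) (ha : 0 ≤ φ₁ a) (hb : φ₁ b ≤ 0)
    (hψa : ψ₁ a = 0) (hψb : ψ₁ b = 0) : ν ≤ μ := by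
  by_contra! hlt
  have hW := H.wronskian_lt Hψ hab hp hppos fun r hr => by
    nlinarith [mul_pos (hφ r hr) (hψ r hr)]
  have hWa : 0 ≤ p a * φ₁ a * ψ a := mul_nonneg
    (mul_nonneg (nonneg_on_Icc_of_pos_on_Ioo hab hp hppos (left_mem_Icc.2 hab.le)) ha)
    (nonneg_on_Icc_of_pos_on_Ioo hab Hψ.continuousOn hψ (left_mem_Icc.2 hab.le))
  have hWb : p b * φ₁ b * ψ b ≤ 0 := mul_nonpos_of_nonpos_of_nonneg
    (mul_nonpos_of_nonneg_of_nonpos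
      (nonneg_on_Icc_of_pos_on_Ioo hab hp hppos (right_mem_Icc.2 hab.le)) hb)
    (nonneg_on_Icc_of_pos_on_Ioo hab Hψ.continuousOn hψ (right_mem_Icc.2 hab.le))
  simp only [wronskian, hψa, hψb, mul_zero, sub_zero] at hW
  linarith

theorem exists_wronskian_eq (H : IsFluxSolution p g a b φ φ₁)
    (Hu : IsFluxSolution p h a b u u₁) (hab : a < b) (hu : ∀ r ∈ Icc a b, 0 < u r) :
    ∃ ξ ∈ Ioo a b, wronskian p φ φ₁ u u₁ ξ =
      p ξ * u ξ ^ 2 * ((φ b / u b - φ a / u a) / (b - a)) := by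
  have hu' : ∀ r ∈ Icc a b, u r ≠ 0 := fun r hr => (hu r hr).ne'
  obtain ⟨ξ, hξ, h⟩ := exists_hasDerivAt_eq_slope (fun r => φ r / u r)
    (fun r => (φ₁ r * u r - φ r * u₁ r) / u r ^ 2) hab (H.continuousOn.div Hu.continuousOn hu')
    fun r hr => (H.hasDerivAt hr).div (Hu.hasDerivAt hr) (hu' r (Ioo_subset_Icc_self hr))
  refine ⟨ξ, hξ, ?_⟩
  rw [← h, wronskian]
  field_simp [hu' ξ (Ioo_subset_Icc_self hξ)]

theorem lt_dirichlet {c ψ ψ₁ : ℝ → ℝ} {μ ν : ℝ}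
    (H : IsFluxSolution p (fun r => (c r - μ) * φ r) a b φ φ₁)
    (Hψ : IsFluxSolution p (fun r => (c r - ν) * ψ r) a b ψ ψ₁) (hab : a < b)
    (hp : ContinuousOn p (Icc a b)) (hppos : ∀ r ∈ Ioo a b, 0 < p r)
    (hφ : ∀ r ∈ Icc a b, 0 < φ r) (hψ : ∀ r ∈ Ioo a b, 0 < ψ r) (ha : ψ a = 0) (hb : ψ b = 0) :
    μ < ν := by
  by_contra! hνμ
  obtain ⟨z, haz, hzb⟩ := exists_between hab
  have hψφ : 0 < ψ z / φ z := div_pos (hψ z ⟨haz, hzb⟩) (hφ z ⟨haz.le, hzb.le⟩)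
  -- The quotient `ψ / φ` first increases and then decreases, so the Wronskian changes sign.
  obtain ⟨ξ, hξ, hWξ⟩ := (Hψ.mono le_rfl hzb.le).exists_wronskian_eq (H.mono le_rfl hzb.le) haz
    fun r hr => hφ r ⟨hr.1, hr.2.trans hzb.le⟩
  obtain ⟨η, hη, hWη⟩ := (Hψ.mono haz.le le_rfl).exists_wronskian_eq (H.mono haz.le le_rfl) hzb
    fun r hr => hφ r ⟨haz.le.trans hr.1, hr.2⟩
  have hξη : ξ < η := hξ.2.trans hη.1
  have hξm : ξ ∈ Ioo a b := ⟨hξ.1, hξ.2.trans hzb⟩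
  have hηm : η ∈ Ioo a b := ⟨haz.trans hη.1, hη.2⟩
  have hpφ : ∀ r ∈ Ioo a b, 0 < p r * φ r ^ 2 := fun r hr =>
    mul_pos (hppos r hr) (pow_pos (hφ r (Ioo_subset_Icc_self hr)) 2)
  have hle : wronskian p ψ ψ₁ φ φ₁ ξ ≤ wronskian p ψ ψ₁ φ φ₁ η := by
    have hsub : Ioo ξ η ⊆ Ioo a b := Ioo_subset_Ioo hξm.1.le hηm.2.le
    refine left_le_right_of_deriv_nonneg hξη.le ((Hψ.continuousOn_wronskian H hp).mono
      (Icc_subset_Icc hξm.1.le hηm.2.le)) (fun r hr => Hψ.hasDerivAt_wronskian H (hsub hr))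
      fun r hr => mul_nonneg (hppos r (hsub hr)).le ?_
    nlinarith [mul_pos (hφ r (Ioo_subset_Icc_self (hsub hr))) (hψ r (hsub hr))]
  rw [hWξ, hWη, ha, hb, zero_div, zero_div, sub_zero, zero_sub] at hle
  have hWξ_pos := mul_pos (hpφ ξ hξm) (div_pos hψφ (sub_pos.2 haz))
  have hWη_neg :=
    mul_neg_of_pos_of_neg (hpφ η hηm) (div_neg_of_neg_of_pos (neg_neg_of_pos hψφ) (sub_pos.2 hzb))
  linarith

end IsFluxSolution

/-- A weight on `[a, b]` that is increasing up to the factor `M`. It may vanish at `a`, as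
`r ^ (d - 1)` does at the origin, and yet `p⁻¹ ∫ₐ p` stays bounded. -/
structure IsAlmostIncreasingWeight (p : ℝ → ℝ) (a b M : ℝ) : Prop where
  continuous : Continuous p
  pos : ∀ r ∈ Ioc a b, 0 < p r
  le_mul : ∀ r ∈ Icc a b, ∀ t ∈ Icc a b, r ≤ t → p r ≤ M * p t

theorem IsAlmostIncreasingWeight.one_le {p : ℝ → ℝ} {a b M : ℝ} (hab : a < b)
    (hp : IsAlmostIncreasingWeight p a b M) : 1 ≤ M := by
  have hb : b ∈ Icc a b := right_mem_Icc.2 hab.le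
  have hpb : 0 < p b := hp.pos b ⟨hab, le_rfl⟩
  nlinarith [hp.le_mul b hb b hb le_rfl]

/-- The mean `p(t)⁻¹ ∫ₐᵗ p g`, which is the derivative of the solution of `(p φ')' = p g` whose
flux vanishes at `a`. The values may lie in any normed space, so that one equation can carry a
whole family of parameters. -/
noncomputable def fluxMean {E : Type*} [NormedAddCommGroup E] [NormedSpace ℝ E] (p : ℝ → ℝ)
    (a : ℝ) (g : ℝ → E) (t : ℝ) : E :=
  (p t)⁻¹ • ∫ τ in a..t, p τ • g τ

section FluxMean

variable {E F : Type*} [NormedAddCommGroup E] [NormedSpace ℝ E] [NormedAddCommGroup F]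
  [NormedSpace ℝ F] {p : ℝ → ℝ} {a b M t : ℝ} {f g : ℝ → E}

theorem fluxMean_self : fluxMean p a g a = 0 := by
  simp only [fluxMean, intervalIntegral.integral_same, smul_zero]

theorem fluxMean_sub (hp : Continuous p) (hf : Continuous f) (hg : Continuous g) :
    fluxMean p a (fun r => f r - g r) t = fluxMean p a f t - fluxMean p a g t := by
  simp only [fluxMean, smul_sub]
  rw [← smul_sub, intervalIntegral.integral_sub]
  exacts [(hp.fun_smul hf).intervalIntegrable _ _, (hp.fun_smul hg).intervalIntegrable _ _]

theorem map_fluxMean [CompleteSpace E] [CompleteSpace F] (A : E →L[ℝ] F) (hp : Continuous p)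
    (hg : Continuous g) : A (fluxMean p a g t) = fluxMean p a (fun τ => A (g τ)) t := by
  rw [fluxMean, map_smul, ← ContinuousLinearMap.intervalIntegral_comp_comm A
    ((hp.fun_smul hg).intervalIntegrable _ _)]
  simp only [fluxMean, map_smul]

theorem norm_fluxMean_le (hp : IsAlmostIncreasingWeight p a b M) {G : ℝ → ℝ} (hG : Continuous G)
    (hgG : ∀ r ∈ Icc a b, ‖g r‖ ≤ G r) (ht : t ∈ Icc a b) :
    ‖fluxMean p a g t‖ ≤ M * ∫ τ in a..t, G τ := by
  rcases eq_or_lt_of_le ht.1 with rfl | hat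
  · simp [fluxMean_self]
  have hpt : 0 < p t := hp.pos t ⟨hat, ht.2⟩
  have hint : ‖∫ τ in a..t, p τ • g τ‖ ≤ ∫ τ in a..t, M * p t * G τ := by
    refine intervalIntegral.norm_integral_le_of_norm_le hat.le (.of_forall fun τ hτ => ?_)
      ((hG.intervalIntegrable _ _).const_mul _)
    have hτ' : τ ∈ Icc a b := ⟨hτ.1.le, hτ.2.trans ht.2⟩
    have hpτ : 0 < p τ := hp.pos τ ⟨hτ.1, hτ'.2⟩
    have hle := hp.le_mul τ hτ' t ht hτ.2
    rw [norm_smul, Real.norm_eq_abs, abs_of_pos hpτ]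
    exact mul_le_mul hle (hgG τ hτ') (norm_nonneg _) (hpτ.le.trans hle)
  rw [intervalIntegral.integral_const_mul] at hint
  rw [fluxMean, norm_smul, norm_inv, Real.norm_eq_abs, abs_of_pos hpt, inv_mul_le_iff₀ hpt]
  linarith

theorem continuousOn_fluxMean (hp : IsAlmostIncreasingWeight p a b M) (hg : Continuous g) :
    ContinuousOn (fluxMean p a g) (Icc a b) := by
  intro t ht
  rcases eq_or_lt_of_le ht.1 with rfl | hat
  · have hbound : Tendsto (fun t => M * ∫ τ in a..t, ‖g τ‖) (𝓝[Icc a b] a) (𝓝 0) := by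
      have hcont : Continuous fun t => M * ∫ τ in a..t, ‖g τ‖ := continuous_const.mul
        (intervalIntegral.continuous_primitive (fun x y => hg.norm.intervalIntegrable x y) a)
      simpa using (hcont.tendsto a).mono_left nhdsWithin_le_nhds
    rw [ContinuousWithinAt, fluxMean_self]
    refine squeeze_zero_norm' ?_ hbound
    filter_upwards [self_mem_nhdsWithin] with t ht
    exact norm_fluxMean_le hp hg.norm (fun _ _ => le_rfl) ht
  · exact ((hp.continuous.continuousAt.inv₀ (hp.pos t ⟨hat, ht.2⟩).ne').smul
      (intervalIntegral.continuous_primitive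
        (fun x y => (hp.continuous.smul hg).intervalIntegrable x y) a).continuousAt)
      |>.continuousWithinAt

theorem intervalIntegrable_fluxMean (hp : IsAlmostIncreasingWeight p a b M) (hg : Continuous g)
    (ht : t ∈ Icc a b) :
    IntervalIntegrable (fluxMean p a g) MeasureTheory.volume a t := by
  refine ((continuousOn_fluxMean hp hg).mono ?_).intervalIntegrable
  rw [uIcc_of_le ht.1]
  exact Icc_subset_Icc_right ht.2

theorem integral_exp_le {κ : ℝ} (hκ : 0 < κ) :
    ∫ τ in a..t, Real.exp (κ * (τ - a)) ≤ Real.exp (κ * (t - a)) / κ := by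
  have hderiv : ∀ τ, HasDerivAt (fun τ => Real.exp (κ * (τ - a)) / κ)
      (Real.exp (κ * (τ - a))) τ := fun τ =>
    ((((hasDerivAt_id τ).sub_const a).const_mul κ).exp.div_const κ).congr_deriv
      (by simp [hκ.ne'])
  rw [intervalIntegral.integral_eq_sub_of_hasDerivAt (fun τ _ => hderiv τ)
    (Continuous.intervalIntegrable (by fun_prop) _ _)]
  exact sub_le_self _ (by positivity)

theorem norm_integral_fluxMean_le (hp : IsAlmostIncreasingWeight p a b M) (hM : 0 ≤ M)
    {κ D : ℝ} (hκ : 0 < κ) (hD : 0 ≤ D)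
    (hgD : ∀ τ ∈ Icc a b, ‖g τ‖ ≤ D * Real.exp (κ * (τ - a))) (ht : t ∈ Icc a b) :
    ‖∫ τ in a..t, fluxMean p a g τ‖ ≤ M * D / κ ^ 2 * Real.exp (κ * (t - a)) := by
  have hbound : ∀ τ ∈ Icc a b,
      ‖fluxMean p a g τ‖ ≤ M * D / κ * Real.exp (κ * (τ - a)) := fun τ hτ =>
    calc ‖fluxMean p a g τ‖ ≤ M * ∫ σ in a..τ, D * Real.exp (κ * (σ - a)) :=
          norm_fluxMean_le hp (by fun_prop) hgD hτ
      _ ≤ M * (D * (Real.exp (κ * (τ - a)) / κ)) := by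
          rw [intervalIntegral.integral_const_mul]
          gcongr
          exact integral_exp_le hκ
      _ = M * D / κ * Real.exp (κ * (τ - a)) := by ring
  calc ‖∫ τ in a..t, fluxMean p a g τ‖ ≤ ∫ τ in a..t, M * D / κ * Real.exp (κ * (τ - a)) :=
        intervalIntegral.norm_integral_le_of_norm_le ht.1
          (.of_forall fun τ hτ => hbound τ ⟨hτ.1.le, hτ.2.trans ht.2⟩)
          (Continuous.intervalIntegrable (by fun_prop) _ _)
    _ ≤ M * D / κ * (Real.exp (κ * (t - a)) / κ) := by
        rw [intervalIntegral.integral_const_mul]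
        gcongr
        exact integral_exp_le hκ
    _ = M * D / κ ^ 2 * Real.exp (κ * (t - a)) := by ring

theorem hasDerivWithinAt_integral_fluxMean [CompleteSpace E]
    (hp : IsAlmostIncreasingWeight p a b M) (hg : Continuous g) (ht : t ∈ Icc a b) :
    HasDerivWithinAt (fun r => ∫ τ in a..r, fluxMean p a g τ) (fluxMean p a g t) (Icc a b) t := by
  have := Fact.mk ht
  exact intervalIntegral.integral_hasDerivWithinAt_right (intervalIntegrable_fluxMean hp hg ht)
    ((continuousOn_fluxMean hp hg).stronglyMeasurableAtFilter_nhdsWithin measurableSet_Icc t)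
    (continuousOn_fluxMean hp hg t ht)

theorem isFluxSolution_fluxMean {φ g : ℝ → ℝ} {v : ℝ} (hp : IsAlmostIncreasingWeight p a b M)
    (hg : Continuous g) (hφ : ∀ r ∈ Icc a b, φ r = v + ∫ t in a..r, fluxMean p a g t) :
    IsFluxSolution p g a b φ (fluxMean p a g) where
  hasDerivWithinAt r hr :=
    ((hasDerivWithinAt_integral_fluxMean hp hg hr).const_add v).congr hφ (hφ r hr)
  continuousOn_deriv := continuousOn_fluxMean hp hg
  hasDerivAt_flux r hr := by
    have hcont : Continuous fun τ => p τ * g τ := hp.continuous.mul hg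
    refine (hcont.integral_hasStrictDerivAt a r).hasDerivAt.congr_of_eventuallyEq ?_
    filter_upwards [Ioo_mem_nhds hr.1 hr.2] with t ht
    simp only [fluxMean, smul_eq_mul]
    rw [mul_inv_cancel_left₀ (hp.pos t ⟨ht.1, ht.2.le⟩).ne']

/-- The function `τ ↦ e^{κ (τ - a)} f(τ)`, extended from `[a, b]` to the line. The sup norm of `f`
is the weighted norm of this function in which Picard iteration contracts once `κ` is large. -/
noncomputable def expExtend (hab : a ≤ b) (κ : ℝ) (f : C(Icc a b, E)) (τ : ℝ) : E :=
  Real.exp (κ * (τ - a)) • IccExtend hab f τ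

theorem continuous_expExtend (hab : a ≤ b) (κ : ℝ) (f : C(Icc a b, E)) :
    Continuous (expExtend hab κ f) :=
  (by fun_prop : Continuous fun τ => Real.exp (κ * (τ - a))).smul f.continuous.Icc_extend'

theorem norm_expExtend_sub_le (hab : a ≤ b) (κ : ℝ) (f g : C(Icc a b, E)) (τ : ℝ) :
    ‖expExtend hab κ f τ - expExtend hab κ g τ‖ ≤ dist f g * Real.exp (κ * (τ - a)) := by
  rw [expExtend, expExtend, ← smul_sub, norm_smul, Real.norm_eq_abs, Real.abs_exp, mul_comm,
    ← dist_eq_norm]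
  gcongr
  exact ContinuousMap.dist_apply_le_dist _

theorem exists_picard_operator [CompleteSpace E] (hab : a < b)
    (hp : IsAlmostIncreasingWeight p a b M) {q : ℝ → E →L[ℝ] E} (hq : Continuous q) {Q κ : ℝ}
    (hQ : ∀ r ∈ Icc a b, ‖q r‖ ≤ Q) (hκ : 0 < κ) (v : E) :
    ∃ S : C(Icc a b, E) → C(Icc a b, E),
      LipschitzWith (Real.toNNReal (M * Q / κ ^ 2)) S ∧
      ∀ f r, S f r = Real.exp (-(κ * (r - a))) •
        (v + ∫ t in a..r, fluxMean p a (fun τ => q τ (expExtend hab.le κ f τ)) t) := by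
  have hM : 0 ≤ M := zero_le_one.trans (hp.one_le hab)
  have hQ0 : 0 ≤ Q := (norm_nonneg _).trans (hQ a (left_mem_Icc.2 hab.le))
  have hcont (f) : Continuous fun τ => q τ (expExtend hab.le κ f τ) :=
    hq.clm_apply (continuous_expExtend hab.le κ f)
  refine ⟨fun f => ⟨fun r => Real.exp (-(κ * (r - a))) •
    (v + ∫ t in a..r, fluxMean p a (fun τ => q τ (expExtend hab.le κ f τ)) t), ?_⟩, ?_,
    fun f r => rfl⟩
  · refine Continuous.smul (by fun_prop) (continuous_const.add ?_)
    exact continuousOn_iff_continuous_domRestrict.1 fun r hr =>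
      (hasDerivWithinAt_integral_fluxMean hp (hcont f) hr).continuousWithinAt
  refine LipschitzWith.of_dist_le' fun f g => (ContinuousMap.dist_le (by positivity)).2 fun r => ?_
  have hbound : ∀ τ ∈ Icc a b, ‖q τ (expExtend hab.le κ f τ) - q τ (expExtend hab.le κ g τ)‖ ≤
      Q * dist f g * Real.exp (κ * (τ - a)) := fun τ hτ => by
    rw [← map_sub, mul_assoc]
    exact (q τ).le_of_opNorm_le_of_le (hQ τ hτ) (norm_expExtend_sub_le hab.le κ f g τ)
  have hdiff := norm_integral_fluxMean_le hp hM hκ (mul_nonneg hQ0 dist_nonneg) hbound r.2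
  simp only [fluxMean_sub hp.continuous (hcont f) (hcont g)] at hdiff
  rw [intervalIntegral.integral_sub (intervalIntegrable_fluxMean hp (hcont f) r.2)
    (intervalIntegrable_fluxMean hp (hcont g) r.2)] at hdiff
  rw [dist_eq_norm, ContinuousMap.coe_mk, ContinuousMap.coe_mk, ← smul_sub, add_sub_add_left_eq_sub,
    norm_smul, Real.norm_eq_abs, Real.abs_exp, Real.exp_neg, inv_mul_le_iff₀ (Real.exp_pos _)]
  exact hdiff.trans_eq (by ring)

theorem exists_volterra_solution [CompleteSpace E] (hab : a < b)
    (hp : IsAlmostIncreasingWeight p a b M) {q : ℝ → E →L[ℝ] E} (hq : Continuous q) (v : E) :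
    ∃ φ : ℝ → E, Continuous φ ∧
      ∀ r ∈ Icc a b, φ r = v + ∫ t in a..r, fluxMean p a (fun τ => q τ (φ τ)) t := by
  obtain ⟨Q, hQ⟩ := isCompact_Icc.exists_bound_of_continuousOn (hq.continuousOn (s := Icc a b))
  have hMQ : 0 ≤ M * Q := mul_nonneg (zero_le_one.trans (hp.one_le hab))
    ((norm_nonneg _).trans (hQ a (left_mem_Icc.2 hab.le)))
  obtain ⟨S, hS, hSf⟩ := exists_picard_operator hab hp hq hQ (κ := 1 + M * Q) (by positivity) v
  have hcontr : ContractingWith (Real.toNNReal (M * Q / (1 + M * Q) ^ 2)) S := by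
    refine ⟨Real.toNNReal_lt_one.2 ?_, hS⟩
    rw [div_lt_one (by positivity)]
    nlinarith
  set f := ContractingWith.fixedPoint S hcontr with hf
  refine ⟨expExtend hab.le (1 + M * Q) f, continuous_expExtend _ _ _, fun r hr => ?_⟩
  have hfix : S f ⟨r, hr⟩ = f ⟨r, hr⟩ := by rw [hf, hcontr.fixedPoint_isFixedPt]
  rw [hSf, Real.exp_neg, inv_smul_eq_iff₀ (Real.exp_ne_zero _)] at hfix
  rw [hfix, expExtend, IccExtend_of_mem hab.le _ hr]

end FluxMean

namespace IsFluxSolution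

variable {p k φ φ₁ : ℝ → ℝ} {a b M : ℝ}

theorem mul_sub_nonneg_of_isMinOn {g : ℝ → ℝ} (H : IsFluxSolution p g a b φ φ₁) {y z : ℝ}
    (hy : y ∈ Icc a b) (hz : z ∈ Icc a b) (hmin : IsMinOn φ (Icc a b) y) :
    0 ≤ (z - y) * φ₁ y := by
  have hcone : z - y ∈ posTangentConeAt (Icc a b) y :=
    sub_mem_posTangentConeAt_of_segment_subset ((convex_Icc a b).segment_subset hy hz)
  simpa using hmin.localize.hasFDerivWithinAt_nonneg
    (H.hasDerivWithinAt y hy).hasFDerivWithinAt hcone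

theorem pos_of_nonneg (H : IsFluxSolution p (fun r => k r * φ r) a b φ φ₁)
    (hp : IsAlmostIncreasingWeight p a b M) (hk : ContinuousOn k (Icc a b)) (ha : 0 < φ a)
    (hnonneg : ∀ r ∈ Icc a b, 0 ≤ φ r) (hb : 0 ≤ φ₁ b) {y : ℝ} (hy : y ∈ Icc a b) : 0 < φ y := by
  by_contra! hy0
  have hφy : φ y = 0 := le_antisymm hy0 (hnonneg y hy)
  have hay : a < y := lt_of_le_of_ne hy.1 fun h => by rw [h, hφy] at ha; exact lt_irrefl 0 ha
  have hmin : IsMinOn φ (Icc a b) y := fun r hr => hφy.trans_le (hnonneg r hr)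
  have hab : a ≤ b := hy.1.trans hy.2
  have hleft := H.mul_sub_nonneg_of_isMinOn hy (left_mem_Icc.2 hab) hmin
  have hφ₁y : φ₁ y = 0 := by
    rcases eq_or_lt_of_le hy.2 with rfl | hyb
    · nlinarith
    · have hright := H.mul_sub_nonneg_of_isMinOn hy (right_mem_Icc.2 hab) hmin
      exact le_antisymm (by nlinarith) (by nlinarith)
  have hzero : ∀ t ∈ Ioo a y, φ t = 0 := fun t ht =>
    (H.mono ht.1.le hy.2).eq_zero_of_right hp.continuous.continuousOn
      (fun r hr => hp.pos r ⟨ht.1.trans_le hr.1, hr.2.trans hy.2⟩)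
      (hk.mono (Icc_subset_Icc ht.1.le hy.2)) hφy hφ₁y (left_mem_Icc.2 ht.2.le)
  have hφa : φ a ≤ 0 := by
    have hcont := (H.mono le_rfl hy.2).continuousOn
    rw [← closure_Ioo hay.ne] at hcont
    exact le_on_closure (fun t ht => (hzero t ht).le) hcont continuousOn_const
      (by rw [closure_Ioo hay.ne]; exact left_mem_Icc.2 hay.le)
  exact hφa.not_gt ha

theorem pos_of_pos_rate (H : IsFluxSolution p (fun r => k r * φ r) a b φ φ₁)
    (hp : IsAlmostIncreasingWeight p a b M) (hk : ∀ r ∈ Ioo a b, 0 < k r) (ha : 0 < φ a)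
    (ha₁ : φ₁ a = 0) {r : ℝ} (hr : r ∈ Icc a b) : 0 < φ r := by
  have hprod : ∀ t ∈ Ioo a b, 0 ≤ φ t * φ₁ t := fun t ht => by
    have hle : φ a * (p a * φ₁ a) ≤ φ t * (p t * φ₁ t) := by
      have Ht := H.mono le_rfl ht.2.le
      refine left_le_right_of_deriv_nonneg ht.1.le
        (Ht.continuousOn.mul (Ht.continuousOn_flux hp.continuous.continuousOn))
        (fun τ hτ => (Ht.hasDerivAt hτ).mul (Ht.hasDerivAt_flux τ hτ)) fun τ hτ => ?_
      have hτ' : τ ∈ Ioo a b := ⟨hτ.1, hτ.2.trans ht.2⟩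
      have hpτ := hp.pos τ (Ioo_subset_Ioc_self hτ')
      have hkτ := hk τ hτ'
      calc 0 ≤ p τ * (φ₁ τ ^ 2 + k τ * φ τ ^ 2) := by positivity
        _ = φ₁ τ * (p τ * φ₁ τ) + φ τ * (p τ * (k τ * φ τ)) := by ring
    rw [ha₁, mul_zero, mul_zero, mul_left_comm] at hle
    exact nonneg_of_mul_nonneg_right hle (hp.pos t (Ioo_subset_Ioc_self ht))
  have hsq : ∀ t ∈ Icc a b, φ a ^ 2 ≤ φ t ^ 2 := fun t ht => by
    have Ht := H.mono le_rfl ht.2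
    refine left_le_right_of_deriv_nonneg ht.1 (Ht.continuousOn.pow 2)
      (fun τ hτ => (Ht.hasDerivAt hτ).pow 2) fun τ hτ => ?_
    have := hprod τ ⟨hτ.1, hτ.2.trans_le ht.2⟩
    push_cast
    linarith
  by_contra! hr0
  obtain ⟨z, hz, hφz⟩ := intermediate_value_Icc' hr.1 (H.mono le_rfl hr.2).continuousOn ⟨hr0, ha.le⟩
  have := hsq z ⟨hz.1, hz.2.trans hr.2⟩
  rw [hφz] at this
  nlinarith

theorem deriv_right_pos {g : ℝ → ℝ} (H : IsFluxSolution p g a b φ φ₁) (hab : a < b)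
    (hp : IsAlmostIncreasingWeight p a b M) (hg : ∀ r ∈ Ioo a b, 0 < g r) (ha₁ : φ₁ a = 0) :
    0 < φ₁ b := by
  have hlt := H.flux_lt hab hp.continuous.continuousOn
    (fun r hr => hp.pos r (Ioo_subset_Ioc_self hr)) hg
  rw [ha₁, mul_zero] at hlt
  exact pos_of_mul_pos_right hlt (hp.pos b ⟨hab, le_rfl⟩).le

end IsFluxSolution

section Shooting

variable {S : Type*} [TopologicalSpace S] {p c : ℝ → ℝ} {a b M : ℝ}

theorem exists_shooting_family [CompactSpace S] (hab : a < b)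
    (hp : IsAlmostIncreasingWeight p a b M) (hc : Continuous c) (μ : C(S, ℝ)) :
    ∃ Φ Φ₁ : ℝ → C(S, ℝ), Continuous Φ ∧ Φ a = 1 ∧ Φ₁ a = 0 ∧ ∀ σ,
      IsFluxSolution p (fun r => (c r - μ σ) * Φ r σ) a b (fun r => Φ r σ) (fun r => Φ₁ r σ) := by
  let k (r : ℝ) : C(S, ℝ) := algebraMap ℝ C(S, ℝ) (c r) - μ
  have hk : Continuous k := ((algebraMapCLM ℝ C(S, ℝ)).continuous.comp hc).sub continuous_const
  obtain ⟨Φ, hΦ, hΦeq⟩ := exists_volterra_solution hab hp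
    ((ContinuousLinearMap.mul ℝ C(S, ℝ)).continuous.comp hk) 1
  have hg : Continuous fun r => k r * Φ r := hk.mul hΦ
  refine ⟨Φ, fluxMean p a fun r => k r * Φ r, hΦ, ?_, fluxMean_self, fun σ => ?_⟩
  · simpa using hΦeq a (left_mem_Icc.2 hab.le)
  have heval (t) : fluxMean p a (fun r => k r * Φ r) t σ =
      fluxMean p a (fun r => (c r - μ σ) * Φ r σ) t :=
    map_fluxMean (ContinuousMap.evalCLM ℝ σ) hp.continuous hg
  simp only [heval]
  refine isFluxSolution_fluxMean (v := 1) hp ((hc.sub continuous_const).mul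
    ((ContinuousMap.evalCLM ℝ σ).continuous.comp hΦ)) fun r hr => ?_
  simp only [← heval]
  rw [hΦeq r hr]
  exact congrArg (1 + ·) (ContinuousLinearMap.intervalIntegral_comp_comm
    (ContinuousMap.evalCLM ℝ σ) (intervalIntegrable_fluxMean hp hg hr)).symm

theorem isOpen_setOf_forall_pos {K : Set ℝ} (hK : IsCompact K) {Φ : ℝ → C(S, ℝ)}
    [LocallyCompactSpace S] (hΦ : Continuous Φ) : IsOpen {σ | ∀ r ∈ K, 0 < Φ r σ} := by
  refine isOpen_iff_eventually.2 fun σ hσ =>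
    hK.eventually_forall_of_forall_eventually fun r hr => ?_
  exact ((by fun_prop : Continuous fun z : S × ℝ => Φ z.2 z.1).tendsto (σ, r)).eventually_const_lt
    (hσ r hr)

theorem isClopen_setOf_pos_shooting [LocallyCompactSpace S]
    (hp : IsAlmostIncreasingWeight p a b M) (hc : ContinuousOn c (Icc a b)) {μ : C(S, ℝ)}
    {Φ Φ₁ : ℝ → C(S, ℝ)} (hΦ : Continuous Φ) (hΦa : Φ a = 1)
    (H : ∀ σ, IsFluxSolution p (fun r => (c r - μ σ) * Φ r σ) a b (fun r => Φ r σ)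
      (fun r => Φ₁ r σ))
    (hne : ∀ σ, (∀ r ∈ Icc a b, 0 < Φ r σ) → Φ₁ b σ ≠ 0) :
    IsClopen {σ | (∀ r ∈ Icc a b, 0 < Φ r σ) ∧ 0 < Φ₁ b σ} := by
  refine ⟨?_, (isOpen_setOf_forall_pos isCompact_Icc hΦ).inter
    (isOpen_lt continuous_const (Φ₁ b).continuous)⟩
  have heq : {σ | (∀ r ∈ Icc a b, 0 < Φ r σ) ∧ 0 < Φ₁ b σ} =
      (⋂ r ∈ Icc a b, {σ | 0 ≤ Φ r σ}) ∩ {σ | 0 ≤ Φ₁ b σ} := by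
    ext σ
    simp only [mem_inter_iff, mem_iInter, mem_ofPred_eq]
    refine ⟨fun hσ => ⟨fun r hr => (hσ.1 r hr).le, hσ.2.le⟩, fun hσ => ?_⟩
    have hpos : ∀ r ∈ Icc a b, 0 < Φ r σ := fun r hr =>
      (H σ).pos_of_nonneg hp (hc.sub continuousOn_const) (by simp [hΦa]) hσ.1 hσ.2 hr
    exact ⟨hpos, lt_of_le_of_ne hσ.2 (hne σ hpos).symm⟩
  rw [heq]
  exact (isClosed_biInter fun r _ => isClosed_le continuous_const (Φ r).continuous).inter
    (isClosed_le continuous_const (Φ₁ b).continuous)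

/-- Shooting from `a` with `φ = 1`, `φ' = 0`: if no `μ` met the Neumann condition at `b`, the `μ`
with `φ > 0` and `φ'(b) > 0` would form a clopen set, but it contains the small `μ` and not the
large ones. -/
theorem exists_neumann_solution_of_continuous (hab : a < b)
    (hp : IsAlmostIncreasingWeight p a b M) (hc : Continuous c) :
    ∃ (μ : ℝ) (φ φ₁ : ℝ → ℝ), IsFluxSolution p (fun r => (c r - μ) * φ r) a b φ φ₁ ∧
      (∀ r ∈ Icc a b, 0 < φ r) ∧ φ₁ a = 0 ∧ φ₁ b = 0 := by
  obtain ⟨L, hL⟩ := isCompact_Icc.exists_bound_of_continuousOn (hc.continuousOn (s := Icc a b))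
  have hL0 : 0 ≤ L := (norm_nonneg _).trans (hL a (left_mem_Icc.2 hab.le))
  have hbounds (r) (hr : r ∈ Ioo a b) : -L ≤ c r ∧ c r ≤ L :=
    abs_le.1 (hL r (Ioo_subset_Icc_self hr))
  obtain ⟨Φ, Φ₁, hΦ, hΦa, hΦ₁a, H⟩ := exists_shooting_family hab hp hc
    (⟨Subtype.val, continuous_subtype_val⟩ : C(Icc (-(L + 1)) (L + 1), ℝ))
  have hΦ₁a' (σ) : Φ₁ a σ = 0 := by rw [hΦ₁a, ContinuousMap.zero_apply]
  by_contra! hno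
  have hclopen := isClopen_setOf_pos_shooting hp hc.continuousOn hΦ hΦa H
    fun σ hσ => hno _ _ _ (H σ) hσ (hΦ₁a' σ)
  have hlow : ∃ σ, (∀ r ∈ Icc a b, 0 < Φ r σ) ∧ 0 < Φ₁ b σ := by
    let σ : Icc (-(L + 1)) (L + 1) := ⟨-(L + 1), by constructor <;> linarith⟩
    have hrate : ∀ r ∈ Ioo a b, 0 < c r - -(L + 1) := fun r hr => by linarith [hbounds r hr]
    have hpos : ∀ r ∈ Icc a b, 0 < Φ r σ := fun r hr =>
      (H σ).pos_of_pos_rate hp hrate (by simp [hΦa]) (hΦ₁a' σ) hr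
    exact ⟨σ, hpos, (H σ).deriv_right_pos hab hp (fun r hr =>
      mul_pos (hrate r hr) (hpos r (Ioo_subset_Icc_self hr))) (hΦ₁a' σ)⟩
  have hhigh : ¬∀ σ, (∀ r ∈ Icc a b, 0 < Φ r σ) ∧ 0 < Φ₁ b σ := fun hall => by
    let σ : Icc (-(L + 1)) (L + 1) := ⟨L + 1, by constructor <;> linarith⟩
    obtain ⟨hpos, hpos₁⟩ := hall σ
    have hneg : ∀ r ∈ Ioo a b, 0 < -1 * ((c r - (L + 1)) * Φ r σ) := fun r hr => by
      nlinarith [hbounds r hr, hpos r (Ioo_subset_Icc_self hr)]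
    have := ((H σ).const_mul (-1)).deriv_right_pos hab hp hneg (by rw [hΦ₁a', mul_zero])
    linarith
  have : PreconnectedSpace (Icc (-(L + 1)) (L + 1)) :=
    Subtype.preconnectedSpace isPreconnected_Icc
  rcases isClopen_iff.1 hclopen with hempty | huniv
  · exact eq_empty_iff_forall_notMem.1 hempty _ hlow.choose_spec
  · exact hhigh (eq_univ_iff_forall.1 huniv)

theorem exists_neumann_solution (hab : a < b) (hp : IsAlmostIncreasingWeight p a b M)
    (hc : ContinuousOn c (Icc a b)) :
    ∃ (μ : ℝ) (φ φ₁ : ℝ → ℝ), IsFluxSolution p (fun r => (c r - μ) * φ r) a b φ φ₁ ∧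
      (∀ r ∈ Icc a b, 0 < φ r) ∧ φ₁ a = 0 ∧ φ₁ b = 0 := by
  obtain ⟨μ, φ, φ₁, H, hφ⟩ := exists_neumann_solution_of_continuous hab hp
    (c := IccExtend hab.le ((Icc a b).domRestrict c)) (by exact hc.domRestrict.Icc_extend')
  refine ⟨μ, φ, φ₁, H.congr (fun _ _ => rfl) fun r hr => ?_, hφ⟩
  rw [IccExtend_of_mem hab.le _ (Ioo_subset_Icc_self hr), domRestrict_apply]

end Shooting

/-- The weight `r ^ (d - 1) * e ^ Q` which puts the radial operator
`φ'' + ((d - 1) / r) φ' + Q' φ'` into divergence form. -/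
noncomputable def radialWeight (d : ℕ) (Q : ℝ → ℝ) (r : ℝ) : ℝ := r ^ (d - 1) * Real.exp (Q r)

section RadialWeight

variable {d : ℕ} {Q : ℝ → ℝ}

theorem radialWeight_pos {r : ℝ} (hr : 0 < r) : 0 < radialWeight d Q r :=
  mul_pos (pow_pos hr _) (Real.exp_pos _)

theorem continuous_radialWeight (hQ : Continuous Q) : Continuous (radialWeight d Q) :=
  (continuous_id.pow _).mul hQ.rexp

theorem hasDerivAt_radialWeight (hd : 1 ≤ d) {q r : ℝ} (hr : 0 < r) (hQ : HasDerivAt Q q r) :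
    HasDerivAt (radialWeight d Q) ((((d : ℝ) - 1) / r + q) * radialWeight d Q r) r := by
  refine ((hasDerivAt_pow (d - 1) r).mul hQ.exp).congr_deriv ?_
  obtain ⟨n, rfl⟩ : ∃ n, d = n + 1 := ⟨d - 1, by omega⟩
  cases n with
  | zero => simp [radialWeight, mul_comm]
  | succ n =>
    simp only [radialWeight, Nat.add_sub_cancel]
    push_cast
    field_simp
    ring

theorem exists_isAlmostIncreasingWeight_radialWeight (hQ : Continuous Q) {a b : ℝ}
    (ha : 0 ≤ a) : ∃ M, IsAlmostIncreasingWeight (radialWeight d Q) a b M := by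
  obtain ⟨K, hK⟩ := isCompact_Icc.exists_bound_of_continuousOn (hQ.continuousOn (s := Icc a b))
  refine ⟨Real.exp (2 * K), continuous_radialWeight hQ,
    fun r hr => radialWeight_pos (ha.trans_lt hr.1), fun r hr t ht hrt => ?_⟩
  have hQr := (abs_le.1 (hK r hr)).2
  have hQt := (abs_le.1 (hK t ht)).1
  calc r ^ (d - 1) * Real.exp (Q r)
      ≤ t ^ (d - 1) * Real.exp (2 * K + Q t) := by
        have hr0 := ha.trans hr.1
        have ht0 := ha.trans ht.1
        gcongr
        linarith
    _ = Real.exp (2 * K) * (t ^ (d - 1) * Real.exp (Q t)) := by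
        rw [Real.exp_add]
        ring

end RadialWeight

section Eigenfunction

variable {d : ℕ} {p v c φ φ₁ : ℝ → ℝ} {a b μ ν : ℝ} {A B : BoundaryType}

theorem hasDerivAt_deriv_of_contDiffOn_two {f : ℝ → ℝ} {s : Set ℝ} (hs : IsOpen s)
    (hf : ContDiffOn ℝ 2 f s) {r : ℝ} (hr : r ∈ s) :
    HasDerivAt (deriv f) (deriv (deriv f) r) r :=
  (((hf.deriv_of_isOpen (m := 1) hs (by norm_num)).differentiableOn one_ne_zero).differentiableAt
    (hs.mem_nhds hr)).hasDerivAt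

theorem contDiffOn_one_of_hasDerivAt {f f' : ℝ → ℝ} {s : Set ℝ} (hs : IsOpen s)
    (hf : ∀ r ∈ s, HasDerivAt f (f' r) r) (hf' : ContinuousOn f' s) : ContDiffOn ℝ 1 f s := by
  rw [← zero_add 1, contDiffOn_succ_iff_deriv_of_isOpen hs, contDiffOn_zero]
  exact ⟨fun r hr => (hf r hr).differentiableAt.differentiableWithinAt, by simp,
    hf'.congr fun r hr => (hf r hr).deriv⟩

theorem contDiffOn_two_of_hasDerivAt {f f' f'' : ℝ → ℝ} {s : Set ℝ} (hs : IsOpen s)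
    (hf : ∀ r ∈ s, HasDerivAt f (f' r) r) (hf' : ∀ r ∈ s, HasDerivAt f' (f'' r) r)
    (hf'' : ContinuousOn f'' s) : ContDiffOn ℝ 2 f s := by
  rw [← one_add_one_eq_two, contDiffOn_succ_iff_deriv_of_isOpen hs]
  exact ⟨fun r hr => (hf r hr).differentiableAt.differentiableWithinAt, by simp,
    (contDiffOn_one_of_hasDerivAt hs hf' hf'').congr fun r hr => (hf r hr).deriv⟩

theorem IsPositiveEigenfunction.isFluxSolution (H : IsPositiveEigenfunction d v c a b A B μ φ)
    (hab : a < b) (hp : ∀ r ∈ Ioo a b, HasDerivAt p ((((d : ℝ) - 1) / r + v r) * p r) r) :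
    IsFluxSolution p (fun r => (c r - μ) * φ r) a b φ (derivWithin φ (Icc a b)) where
  hasDerivWithinAt r hr :=
    (H.contDiffOn_closed.differentiableOn one_ne_zero r hr).hasDerivWithinAt
  continuousOn_deriv := H.contDiffOn_closed.continuousOn_derivWithin (uniqueDiffOn_Icc hab) le_rfl
  hasDerivAt_flux r hr := by
    have hflux := (hp r hr).fun_mul
      (hasDerivAt_deriv_of_contDiffOn_two isOpen_Ioo H.contDiffOn_open hr)
    refine (hflux.congr_of_eventuallyEq ?_).congr_deriv ?_
    · filter_upwards [Ioo_mem_nhds hr.1 hr.2] with t ht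
      rw [derivWithin_of_mem_nhds (Icc_mem_nhds ht.1 ht.2)]
    · linear_combination (-p r) * H.equation r hr

theorem IsFluxSolution.hasDerivAt_deriv {g : ℝ → ℝ} (H : IsFluxSolution p g a b φ φ₁)
    (hpos : ∀ r ∈ Ioo a b, 0 < p r)
    (hp : ∀ r ∈ Ioo a b, HasDerivAt p ((((d : ℝ) - 1) / r + v r) * p r) r) {r : ℝ}
    (hr : r ∈ Ioo a b) : HasDerivAt φ₁ (g r - (((d : ℝ) - 1) / r + v r) * φ₁ r) r := by
  have hne := (hpos r hr).ne'
  refine (((H.hasDerivAt_flux r hr).fun_div (hp r hr) hne).congr_of_eventuallyEq ?_).congr_deriv ?_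
  · filter_upwards [Ioo_mem_nhds hr.1 hr.2] with t ht
    rw [mul_div_cancel_left₀ _ (hpos t ht).ne']
  · field_simp

theorem IsFluxSolution.isPositiveEigenfunction
    (H : IsFluxSolution p (fun r => (c r - μ) * φ r) a b φ φ₁) (hab : a < b) (ha : 0 ≤ a)
    (hc : ContinuousOn c (Icc a b)) (hv : ContinuousOn v (Ioo a b))
    (hpos : ∀ r ∈ Ioo a b, 0 < p r)
    (hp : ∀ r ∈ Ioo a b, HasDerivAt p ((((d : ℝ) - 1) / r + v r) * p r) r)
    (hφ : ∀ r ∈ Ioo a b, 0 < φ r) (hφa : φ₁ a = 0) (hφb : φ₁ b = 0) :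
    IsPositiveEigenfunction d v c a b .neumann .neumann μ φ := by
  have hderivWithin : ∀ r ∈ Icc a b, derivWithin φ (Icc a b) r = φ₁ r := fun r hr =>
    (H.hasDerivWithinAt r hr).derivWithin (uniqueDiffOn_Icc hab r hr)
  have hsecond : ∀ r ∈ Ioo a b, HasDerivAt φ₁
      ((c r - μ) * φ r - (((d : ℝ) - 1) / r + v r) * φ₁ r) r := fun r hr =>
    H.hasDerivAt_deriv hpos hp hr
  refine ⟨?_, ?_, fun r hr => ?_, (hderivWithin a (left_mem_Icc.2 hab.le)).trans hφa,
    (hderivWithin b (right_mem_Icc.2 hab.le)).trans hφb, hφ⟩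
  · rw [← zero_add 1, contDiffOn_succ_iff_derivWithin (uniqueDiffOn_Icc hab), contDiffOn_zero]
    exact ⟨fun r hr => (H.hasDerivWithinAt r hr).differentiableWithinAt, by simp,
      H.continuousOn_deriv.congr hderivWithin⟩
  · refine contDiffOn_two_of_hasDerivAt isOpen_Ioo (fun r hr => H.hasDerivAt hr) hsecond ?_
    have hsub : Ioo a b ⊆ Icc a b := Ioo_subset_Icc_self
    have hdiv : ContinuousOn (fun r : ℝ => ((d : ℝ) - 1) / r) (Ioo a b) :=
      continuousOn_const.div continuousOn_id fun r hr => (ha.trans_lt hr.1).ne'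
    exact (((hc.mono hsub).sub continuousOn_const).mul (H.continuousOn.mono hsub)).sub
      ((hdiv.add hv).mul (H.continuousOn_deriv.mono hsub))
  · have hderiv : deriv φ =ᶠ[𝓝 r] φ₁ := by
      filter_upwards [Ioo_mem_nhds hr.1 hr.2] with t ht
      exact (H.hasDerivAt ht).deriv
    rw [hderiv.deriv_eq, hderiv.eq_of_nhds, (hsecond r hr).deriv]
    ring

theorem IsPrincipalEigenvalue.le_of_neumann (hab : a < b) (hcont : ContinuousOn p (Icc a b))
    (hpos : ∀ r ∈ Ioo a b, 0 < p r)
    (hp : ∀ r ∈ Ioo a b, HasDerivAt p ((((d : ℝ) - 1) / r + v r) * p r) r)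
    (hμ : IsPrincipalEigenvalue d v c a b .neumann .neumann μ)
    (hν : IsPrincipalEigenvalue d v c a b .neumann .neumann ν) : ν ≤ μ := by
  obtain ⟨φ, hφ⟩ := hμ
  obtain ⟨ψ, hψ⟩ := hν
  exact (hφ.isFluxSolution hab hp).neumann_le (hψ.isFluxSolution hab hp) hab hcont hpos hφ.pos
    hψ.pos hφ.left.ge hφ.right.le hψ.left hψ.right

theorem exists_neumann_eigenvalue (hd : 1 ≤ d) (hab : a < b) (ha : 0 ≤ a)
    (hc : ContinuousOn c (Icc a b)) {Q : ℝ → ℝ} (hQ : ∀ r, HasDerivAt Q (v r) r)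
    (hv : Continuous v) :
    ∃ (lam : ℝ) (φ : ℝ → ℝ), IsPositiveEigenfunction d v c a b .neumann .neumann lam φ ∧
      (∀ r ∈ Icc a b, 0 < φ r) ∧
      ∀ μ, IsPrincipalEigenvalue d v c a b .neumann .neumann μ ↔ μ = lam := by
  have hQc : Continuous Q := continuous_iff_continuousAt.2 fun r => (hQ r).continuousAt
  have hpos : ∀ r ∈ Ioo a b, 0 < radialWeight d Q r := fun r hr =>
    radialWeight_pos (ha.trans_lt hr.1)
  have hp : ∀ r ∈ Ioo a b, HasDerivAt (radialWeight d Q) _ r := fun r hr =>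
    hasDerivAt_radialWeight hd (ha.trans_lt hr.1) (hQ r)
  obtain ⟨M, hM⟩ := exists_isAlmostIncreasingWeight_radialWeight (d := d) (b := b) hQc ha
  obtain ⟨lam, φ, φ₁, H, hφ, hφa, hφb⟩ := exists_neumann_solution hab hM hc
  have hlam := H.isPositiveEigenfunction hab ha hc hv.continuousOn hpos hp
    (fun r hr => hφ r (Ioo_subset_Icc_self hr)) hφa hφb
  have hle {μ ν : ℝ} := IsPrincipalEigenvalue.le_of_neumann (c := c) (μ := μ) (ν := ν) hab
    hM.continuous.continuousOn hpos hp
  exact ⟨lam, φ, hlam, hφ, fun μ =>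
    ⟨fun hμ => (hle ⟨φ, hlam⟩ hμ).antisymm (hle hμ ⟨φ, hlam⟩), fun h => h ▸ ⟨φ, hlam⟩⟩⟩

end Eigenfunction

/-- The slowly varying phase of the oscillation: for small `x` it changes by at most `1` on
`[x / 2, x]`, and by at most `π / 2` on `[x ^ 2, x]`. -/
noncomputable def oscPhase (x : ℝ) : ℝ := Real.log (1 + Real.log x ^ 2)

/-- A `C¹` function that vanishes on `(-∞, 0]` and changes sign infinitely often at `0+`. -/
noncomputable def osc (x : ℝ) : ℝ := if 0 < x then x ^ 2 * Real.sin (oscPhase x) else 0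

/-- The derivative of `osc`. -/
noncomputable def oscDeriv (x : ℝ) : ℝ :=
  if 0 < x then 2 * x * Real.sin (oscPhase x) +
    x * (Real.cos (oscPhase x) * (2 * Real.log x / (1 + Real.log x ^ 2))) else 0

section Osc

theorem osc_of_pos {x : ℝ} (hx : 0 < x) : osc x = x ^ 2 * Real.sin (oscPhase x) := if_pos hx

theorem osc_of_nonpos {x : ℝ} (hx : x ≤ 0) : osc x = 0 := if_neg hx.not_gt

theorem osc_eventuallyEq_of_pos {x : ℝ} (hx : 0 < x) :
    osc =ᶠ[𝓝 x] fun t => t ^ 2 * Real.sin (oscPhase t) := by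
  filter_upwards [Ioi_mem_nhds hx] with t ht using osc_of_pos ht

theorem oscDeriv_eventuallyEq_of_pos {x : ℝ} (hx : 0 < x) :
    oscDeriv =ᶠ[𝓝 x] fun t => 2 * t * Real.sin (oscPhase t) +
      t * (Real.cos (oscPhase t) * (2 * Real.log t / (1 + Real.log t ^ 2))) := by
  filter_upwards [Ioi_mem_nhds hx] with t ht using if_pos ht

theorem eventuallyEq_zero_of_neg {x : ℝ} (hx : x < 0) : osc =ᶠ[𝓝 x] 0 ∧ oscDeriv =ᶠ[𝓝 x] 0 := by
  constructor <;> filter_upwards [Iio_mem_nhds hx] with t ht using if_neg (lt_asymm ht)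

theorem abs_osc_le (x : ℝ) : |osc x| ≤ x ^ 2 := by
  unfold osc
  split_ifs
  · rw [abs_mul, abs_of_nonneg (sq_nonneg x)]
    exact mul_le_of_le_one_right (sq_nonneg x) (Real.abs_sin_le_one _)
  · simpa using sq_nonneg x

theorem abs_oscDeriv_le (x : ℝ) : |oscDeriv x| ≤ 3 * |x| := by
  unfold oscDeriv
  split_ifs with hx
  · have hrate : |2 * Real.log x / (1 + Real.log x ^ 2)| ≤ 1 := by
      rw [abs_div, abs_of_pos (by positivity : 0 < 1 + Real.log x ^ 2),
        div_le_one (by positivity), abs_le]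
      constructor <;> nlinarith [sq_nonneg (Real.log x + 1), sq_nonneg (Real.log x - 1)]
    have hcos : |Real.cos (oscPhase x) * (2 * Real.log x / (1 + Real.log x ^ 2))| ≤ 1 := by
      rw [abs_mul]
      exact mul_le_one₀ (Real.abs_cos_le_one _) (abs_nonneg _) hrate
    calc _ ≤ |2 * x * Real.sin (oscPhase x)| + _ := abs_add_le _ _
      _ ≤ 2 * |x| * 1 + |x| * 1 := by
        rw [abs_mul, abs_mul, abs_mul x, abs_two]
        gcongr
        exact Real.abs_sin_le_one _
      _ = 3 * |x| := by ring
  · simp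

theorem hasDerivAt_oscPhase {x : ℝ} (hx : x ≠ 0) :
    HasDerivAt oscPhase (2 * Real.log x * x⁻¹ / (1 + Real.log x ^ 2)) x := by
  have hsq : HasDerivAt (fun t => 1 + Real.log t ^ 2) (2 * Real.log x * x⁻¹) x :=
    (((Real.hasDerivAt_log hx).fun_pow 2).const_add 1).congr_deriv (by simp)
  exact hsq.log (by positivity)

theorem hasDerivAt_osc_of_ne {x : ℝ} (hx : x ≠ 0) : HasDerivAt osc (oscDeriv x) x := by
  rcases hx.lt_or_gt with hx | hx
  · rw [(eventuallyEq_zero_of_neg hx).2.eq_of_nhds]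
    exact (hasDerivAt_const x 0).congr_of_eventuallyEq (eventuallyEq_zero_of_neg hx).1
  · rw [(oscDeriv_eventuallyEq_of_pos hx).eq_of_nhds]
    refine (((hasDerivAt_pow 2 x).mul (hasDerivAt_oscPhase hx.ne').sin).congr_of_eventuallyEq
      (osc_eventuallyEq_of_pos hx)).congr_deriv ?_
    field_simp
    ring

theorem continuousAt_osc_zero : ContinuousAt osc 0 := by
  rw [ContinuousAt, osc_of_nonpos le_rfl]
  exact squeeze_zero_norm abs_osc_le (Continuous.tendsto' (by fun_prop) 0 0 (by simp))

theorem continuousAt_oscDeriv_zero : ContinuousAt oscDeriv 0 := by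
  rw [ContinuousAt, show oscDeriv 0 = 0 from if_neg (lt_irrefl 0)]
  exact squeeze_zero_norm abs_oscDeriv_le
    (Continuous.tendsto' (by fun_prop) 0 0 (by simp))

theorem hasDerivAt_osc (x : ℝ) : HasDerivAt osc (oscDeriv x) x :=
  hasDerivAt_of_hasDerivAt_of_ne' (fun _ => hasDerivAt_osc_of_ne) continuousAt_osc_zero
    continuousAt_oscDeriv_zero x

theorem continuous_oscDeriv : Continuous oscDeriv := by
  refine continuous_iff_continuousAt.2 fun x => ?_
  rcases lt_trichotomy x 0 with hx | rfl | hx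
  · exact (continuousAt_const (y := (0 : ℝ))).congr (eventuallyEq_zero_of_neg hx).2.symm
  · exact continuousAt_oscDeriv_zero
  · have hphase : ContinuousAt oscPhase x := (hasDerivAt_oscPhase hx.ne').continuousAt
    have hlog : ContinuousAt Real.log x := Real.continuousAt_log hx.ne'
    have hden : 1 + Real.log x ^ 2 ≠ 0 := by positivity
    exact ContinuousAt.congr (by fun_prop (disch := assumption))
      (oscDeriv_eventuallyEq_of_pos hx).symm

end Osc

/-- `x` is a scale at which `m` peaks: `m` is of order `x ^ 2` on `[x / 2, x]`, whereas on all of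
`[0, x]` it is bounded below by the far smaller `-x ^ 4`. -/
structure IsPeakScale (m : ℝ → ℝ) (x : ℝ) : Prop where
  peak_le : ∀ t ∈ Icc (x / 2) x, x ^ 2 / 8 ≤ m t
  neg_le : ∀ t ∈ Icc 0 x, -x ^ 4 ≤ m t

section Peaks

variable {x t : ℝ}

theorem IsPeakScale.pos {m : ℝ → ℝ} (h : IsPeakScale m x) (hx : 0 < x) : 0 < m x :=
  (by positivity : 0 < x ^ 2 / 8).trans_le (h.peak_le x ⟨half_le_self hx.le, le_rfl⟩)

theorem IsPeakScale.congr {m k : ℝ → ℝ} (h : IsPeakScale m x) (hx : 0 < x)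
    (hkm : ∀ t ∈ Icc 0 x, k t = m t) : IsPeakScale k x where
  peak_le t ht := (h.peak_le t ht).trans_eq (hkm t ⟨(half_pos hx).le.trans ht.1, ht.2⟩).symm
  neg_le t ht := (h.neg_le t ht).trans_eq (hkm t ht).symm

theorem oscPhase_le_oscPhase (hx : Real.log x ≤ -1) (ht : 0 < t) (htx : t ≤ x) :
    oscPhase x ≤ oscPhase t := by
  have hlog := Real.log_le_log ht htx
  exact Real.log_le_log (by positivity) (by nlinarith)

theorem oscPhase_le_add_one (hx : 0 < x) (hlogx : Real.log x ≤ -1) (hxt : x / 2 ≤ t)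
    (htx : t ≤ x) : oscPhase t ≤ oscPhase x + 1 := by
  have hlogt : -Real.log t ≤ -Real.log x + 0.7 := by
    have := Real.log_le_log (half_pos hx) hxt
    rw [Real.log_div hx.ne' two_ne_zero] at this
    linarith [Real.log_two_lt_d9]
  have hsq : Real.log t ^ 2 ≤ (-Real.log x + 0.7) ^ 2 := by
    rw [← neg_sq]
    have := Real.log_le_log ((half_pos hx).trans_le hxt) htx
    exact pow_le_pow_left₀ (by linarith) hlogt 2
  rw [oscPhase, Real.log_le_iff_le_exp (by positivity), Real.exp_add, oscPhase,
    Real.exp_log (by positivity)]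
  have hexp : (1 + Real.log x ^ 2) * 2.7 ≤ (1 + Real.log x ^ 2) * Real.exp 1 := by
    gcongr
    linarith [Real.exp_one_gt_d9]
  nlinarith [sq_nonneg (Real.log x + 1)]

theorem le_sq_of_oscPhase_add_lt (hx : 0 < x) (hlogx : Real.log x ≤ -1) (ht : 0 < t)
    (htx : t ≤ x) (h : oscPhase x + Real.pi / 2 < oscPhase t) : t ≤ x ^ 2 := by
  have hexp : 4 ≤ Real.exp (Real.pi / 2) := by
    have : Real.exp 1 * Real.exp (1 / 2) ≤ Real.exp (Real.pi / 2) := by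
      rw [← Real.exp_add]
      exact Real.exp_le_exp.2 (by linarith [Real.pi_gt_three])
    nlinarith [Real.exp_one_gt_d9, Real.add_one_le_exp (1 / 2 : ℝ)]
  rw [oscPhase, oscPhase, Real.lt_log_iff_exp_lt (by positivity), Real.exp_add,
    Real.exp_log (by positivity)] at h
  have hlogt := Real.log_le_log ht htx
  have hlog : 2 * -Real.log x ≤ -Real.log t := le_of_sq_le_sq (by nlinarith) (by linarith)
  rw [← Real.log_le_log_iff ht (by positivity), Real.log_pow]
  push_cast
  linarith

theorem isPeakScale_of_sin_eq_one (hx : 0 < x) (hlogx : Real.log x ≤ -1) {α : ℝ}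
    (hsin : Real.sin (oscPhase x + α) = 1) :
    IsPeakScale (fun t => t ^ 2 * Real.sin (oscPhase t + α)) x := by
  have hcos : Real.cos (oscPhase x + α) = 0 := by
    have := Real.sin_sq_add_cos_sq (oscPhase x + α)
    rw [hsin] at this
    exact pow_eq_zero_iff two_ne_zero |>.1 (by linarith)
  have hsin_eq (t : ℝ) : Real.sin (oscPhase t + α) = Real.cos (oscPhase t - oscPhase x) := by
    rw [show oscPhase t + α = oscPhase x + α + (oscPhase t - oscPhase x) by ring, Real.sin_add,
      hsin, hcos, one_mul, zero_mul, add_zero]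
  refine ⟨fun t ht => ?_, fun t ht => ?_⟩
  · have ht0 : 0 < t := (half_pos hx).trans_le ht.1
    have hlower := oscPhase_le_oscPhase hlogx ht0 ht.2
    have hupper := oscPhase_le_add_one hx hlogx ht.1 ht.2
    have hhalf : 1 / 2 ≤ Real.sin (oscPhase t + α) := by
      rw [hsin_eq]
      nlinarith [Real.one_sub_sq_div_two_le_cos (x := oscPhase t - oscPhase x)]
    nlinarith [pow_le_pow_left₀ (half_pos hx).le ht.1 2]
  · rcases ht.1.eq_or_lt with rfl | ht0
    · simpa using (pow_pos hx 4).le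
    rcases le_or_gt (oscPhase t) (oscPhase x + Real.pi / 2) with hclose | hfar
    · have hnonneg : 0 ≤ Real.sin (oscPhase t + α) := by
        rw [hsin_eq]
        exact Real.cos_nonneg_of_neg_pi_div_two_le_of_le
          (by linarith [oscPhase_le_oscPhase hlogx ht0 ht.2, Real.pi_pos]) (by linarith)
      exact (neg_nonpos.2 (pow_pos hx 4).le).trans (mul_nonneg (sq_nonneg t) hnonneg)
    · have := pow_le_pow_left₀ ht0.le (le_sq_of_oscPhase_add_lt hx hlogx ht0 ht.2 hfar) 2
      nlinarith [Real.neg_one_le_sin (oscPhase t + α), sq_nonneg t]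

theorem oscPhase_exp_neg_sqrt {θ : ℝ} (hθ : 0 ≤ θ) :
    oscPhase (Real.exp (-√(Real.exp θ - 1))) = θ := by
  rw [oscPhase, Real.log_exp, neg_sq, Real.sq_sqrt (by linarith [Real.one_le_exp hθ]),
    add_sub_cancel, Real.log_exp]

theorem frequently_isPeakScale_sin (α : ℝ) :
    ∃ᶠ x in 𝓝[>] 0, IsPeakScale (fun t => t ^ 2 * Real.sin (oscPhase t + α)) x := by
  have hθ : Tendsto (fun n : ℕ => Real.pi / 2 - α + n * (2 * Real.pi)) atTop atTop :=
    tendsto_atTop_add_const_left _ _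
      (tendsto_natCast_atTop_atTop.atTop_mul_const Real.two_pi_pos)
  have hsqrt : Tendsto (fun θ : ℝ => √(Real.exp θ - 1)) atTop atTop :=
    Real.tendsto_sqrt_atTop.comp (tendsto_atTop_add_const_right _ _ Real.tendsto_exp_atTop)
  have hscale : Tendsto (fun n : ℕ => Real.exp (-√(Real.exp (Real.pi / 2 - α + n * (2 * Real.pi))
      - 1))) atTop (𝓝[>] 0) :=
    tendsto_nhdsWithin_iff.2
      ⟨Real.tendsto_exp_atBot.comp (tendsto_neg_atTop_atBot.comp (hsqrt.comp hθ)),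
        .of_forall fun _ => Real.exp_pos _⟩
  refine hscale.frequently (Eventually.frequently ?_)
  filter_upwards [hθ.eventually_ge_atTop 0, (hsqrt.comp hθ).eventually_ge_atTop 1] with n hn hlog
  refine isPeakScale_of_sin_eq_one (Real.exp_pos _) ?_ ?_
  · rw [Real.log_exp]
    exact neg_le_neg hlog
  · rw [oscPhase_exp_neg_sqrt hn, add_right_comm, Real.sin_add_nat_mul_two_pi, sub_add_cancel,
      Real.sin_pi_div_two]

theorem osc_of_nonneg {t : ℝ} (ht : 0 ≤ t) : osc t = t ^ 2 * Real.sin (oscPhase t) := by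
  rcases ht.eq_or_lt with rfl | ht
  · simp [osc]
  · exact osc_of_pos ht

theorem frequently_isPeakScale_osc : ∃ᶠ x in 𝓝[>] 0, IsPeakScale osc x := by
  refine (frequently_isPeakScale_sin 0).mp ?_
  filter_upwards [self_mem_nhdsWithin] with x hx h
  exact h.congr hx fun t ht => by rw [osc_of_nonneg ht.1, add_zero]

theorem frequently_isPeakScale_neg_osc : ∃ᶠ x in 𝓝[>] 0, IsPeakScale (fun t => -osc t) x := by
  refine (frequently_isPeakScale_sin Real.pi).mp ?_
  filter_upwards [self_mem_nhdsWithin] with x hx h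
  exact h.congr hx fun t ht => by rw [osc_of_nonneg ht.1, Real.sin_add_pi, mul_neg]

end Peaks

/-- The infinitely oscillating potential `m` of the theorem. -/
noncomputable def oscDrift (r : ℝ) : ℝ := osc (1 / 3 - r) + osc (r - 2 / 3)

section OscDrift

theorem oscDrift_eq_zero {r : ℝ} (hr : r ∈ Icc (1 / 3 : ℝ) (2 / 3)) : oscDrift r = 0 := by
  rw [oscDrift, osc_of_nonpos (sub_nonpos.2 hr.1), osc_of_nonpos (sub_nonpos.2 hr.2), add_zero]

theorem oscDrift_one_sub (r : ℝ) : oscDrift (1 - r) = oscDrift r := by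
  rw [oscDrift, oscDrift, add_comm]
  congr 2 <;> ring

theorem oscDrift_third_sub {t : ℝ} (ht : 0 ≤ t) : oscDrift (1 / 3 - t) = osc t := by
  rw [oscDrift, osc_of_nonpos (by linarith : 1 / 3 - t - 2 / 3 ≤ 0), add_zero, sub_sub_cancel]

theorem oscDrift_two_thirds_add {t : ℝ} (ht : 0 ≤ t) : oscDrift (2 / 3 + t) = osc t := by
  rw [← oscDrift_third_sub ht, ← oscDrift_one_sub]
  congr 1
  ring

theorem hasDerivAt_oscDrift (r : ℝ) :
    HasDerivAt oscDrift (-oscDeriv (1 / 3 - r) + oscDeriv (r - 2 / 3)) r :=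
  ((hasDerivAt_osc (1 / 3 - r)).comp_const_sub (1 / 3) r).add
    ((hasDerivAt_osc (r - 2 / 3)).comp_sub_const r (2 / 3))

theorem contDiff_oscDrift : ContDiff ℝ 1 oscDrift := by
  rw [contDiff_one_iff_deriv, funext fun r => (hasDerivAt_oscDrift r).deriv]
  have := continuous_oscDeriv
  exact ⟨fun r => (hasDerivAt_oscDrift r).differentiableAt, by fun_prop⟩

theorem frequently_isPeakScale_oscDrift :
    ∃ᶠ x in 𝓝[>] 0, IsPeakScale (fun t => oscDrift (1 / 3 - t)) x := by
  refine frequently_isPeakScale_osc.mp ?_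
  filter_upwards [self_mem_nhdsWithin] with x hx h
  exact h.congr hx fun t ht => oscDrift_third_sub ht.1

theorem frequently_isPeakScale_neg_oscDrift :
    ∃ᶠ x in 𝓝[>] 0, IsPeakScale (fun t => -oscDrift (1 / 3 - t)) x := by
  refine frequently_isPeakScale_neg_osc.mp ?_
  filter_upwards [self_mem_nhdsWithin] with x hx h
  exact h.congr hx fun t ht => by rw [oscDrift_third_sub ht.1]

theorem oscillatesInfinitely_osc : OscillatesInfinitely osc (𝓝[>] 0) := by
  refine ⟨frequently_isPeakScale_osc.mp ?_, frequently_isPeakScale_neg_osc.mp ?_⟩ <;>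
    filter_upwards [self_mem_nhdsWithin] with x hx h
  exacts [h.pos hx, neg_pos.1 (h.pos hx)]

theorem oscillatesInfinitely_of_tendsto_osc {f : ℝ → ℝ} {l : Filter ℝ}
    (hf : Tendsto f (𝓝[>] 0) l) (hosc : ∀ t, 0 ≤ t → oscDrift (f t) = osc t) :
    OscillatesInfinitely oscDrift l := by
  have hmap (P : ℝ → Prop) (hP : ∃ᶠ t in 𝓝[>] 0, P (osc t)) : ∃ᶠ r in l, P (oscDrift r) := by
    refine hf.frequently (hP.mp ?_)
    filter_upwards [self_mem_nhdsWithin] with t ht h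
    rwa [hosc t (le_of_lt ht)]
  exact ⟨hmap _ oscillatesInfinitely_osc.1, hmap (· < 0) oscillatesInfinitely_osc.2⟩

theorem oscillatesInfinitely_left : OscillatesInfinitely oscDrift (𝓝[<] (1 / 3)) := by
  refine oscillatesInfinitely_of_tendsto_osc (tendsto_nhdsWithin_iff.2 ⟨?_, ?_⟩)
    fun t => oscDrift_third_sub
  · exact (Continuous.tendsto' (by fun_prop) 0 _ (sub_zero _)).mono_left nhdsWithin_le_nhds
  · filter_upwards [self_mem_nhdsWithin] with t ht using sub_lt_self _ (mem_Ioi.1 ht)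

theorem oscillatesInfinitely_right : OscillatesInfinitely oscDrift (𝓝[>] (2 / 3)) := by
  refine oscillatesInfinitely_of_tendsto_osc (tendsto_nhdsWithin_iff.2 ⟨?_, ?_⟩)
    fun t => oscDrift_two_thirds_add
  · exact (Continuous.tendsto' (by fun_prop) 0 _ (add_zero _)).mono_left nhdsWithin_le_nhds
  · filter_upwards [self_mem_nhdsWithin] with t ht using lt_add_of_pos_right _ (mem_Ioi.1 ht)

end OscDrift

/-- `φ` is a positive solution of `(p φ')' = p k φ` on `[a, e]` with positive rate `k` and
`φ'(a) = 0`, so that `φ` and its flux `p φ'` are increasing. The weight may vanish at `a`. This is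
how a principal eigenfunction behaves where the potential exceeds the eigenvalue. -/
structure IsGrowingSolution (p k : ℝ → ℝ) (a e : ℝ) (φ φ₁ : ℝ → ℝ) : Prop where
  isFluxSolution : IsFluxSolution p (fun r => k r * φ r) a e φ φ₁
  continuousOn_weight : ContinuousOn p (Icc a e)
  weight_pos : ∀ r ∈ Ioc a e, 0 < p r
  rate_pos : ∀ r ∈ Ioo a e, 0 < k r
  pos : ∀ r ∈ Ioc a e, 0 < φ r
  deriv_left : φ₁ a = 0

section DerivBounds

variable {f f' : ℝ → ℝ} {a b C : ℝ}

theorem mul_sub_le_sub_of_le_deriv (hab : a ≤ b) (hf : ContinuousOn f (Icc a b))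
    (hf' : ∀ r ∈ Ioo a b, HasDerivAt f (f' r) r) (hC : ∀ r ∈ Ioo a b, C ≤ f' r) :
    C * (b - a) ≤ f b - f a := by
  have := left_le_right_of_deriv_nonneg hab (f := fun r => f r - C * r)
    (hf.sub (by fun_prop)) (fun r hr => (hf' r hr).sub ((hasDerivAt_id r).const_mul C))
    fun r hr => by linarith [hC r hr]
  linarith

theorem sub_le_mul_sub_of_deriv_le (hab : a ≤ b) (hf : ContinuousOn f (Icc a b))
    (hf' : ∀ r ∈ Ioo a b, HasDerivAt f (f' r) r) (hC : ∀ r ∈ Ioo a b, f' r ≤ C) :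
    f b - f a ≤ C * (b - a) := by
  have := mul_sub_le_sub_of_le_deriv hab hf.neg (fun r hr => (hf' r hr).neg)
    fun r hr => neg_le_neg (hC r hr)
  simp only [Pi.neg_apply] at this
  linarith

end DerivBounds

namespace IsGrowingSolution

variable {p k φ φ₁ : ℝ → ℝ} {a e x : ℝ}

theorem deriv_pos (H : IsGrowingSolution p k a e φ φ₁) {r : ℝ} (hr : r ∈ Ioc a e) :
    0 < φ₁ r := by
  have hflux := (H.isFluxSolution.mono le_rfl hr.2).flux_lt hr.1
    (H.continuousOn_weight.mono (Icc_subset_Icc_right hr.2))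
    (fun t ht => H.weight_pos t ⟨ht.1, ht.2.le.trans hr.2⟩)
    fun t ht => mul_pos (H.rate_pos t ⟨ht.1, ht.2.trans_le hr.2⟩)
      (H.pos t ⟨ht.1, ht.2.le.trans hr.2⟩)
  rw [H.deriv_left, mul_zero] at hflux
  exact pos_of_mul_pos_right hflux (H.weight_pos r hr).le

theorem monotoneOn (H : IsGrowingSolution p k a e φ φ₁) : MonotoneOn φ (Icc a e) :=
  fun _ hr _ ht hrt => left_le_right_of_deriv_nonneg hrt
    (H.isFluxSolution.mono hr.1 ht.2).continuousOn
    (fun _ => (H.isFluxSolution.mono hr.1 ht.2).hasDerivAt)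
    fun _ hq => (H.deriv_pos ⟨hr.1.trans_lt hq.1, hq.2.le.trans ht.2⟩).le

theorem monotoneOn_flux (H : IsGrowingSolution p k a e φ φ₁) :
    MonotoneOn (fun r => p r * φ₁ r) (Icc a e) :=
  fun _ hr _ ht hrt => (H.isFluxSolution.mono hr.1 ht.2).flux_le hrt
    (H.continuousOn_weight.mono (Icc_subset_Icc hr.1 ht.2)) fun q hq =>
      have hq' : q ∈ Ioo a e := ⟨hr.1.trans_lt hq.1, hq.2.trans_le ht.2⟩
      (mul_pos (H.weight_pos q (Ioo_subset_Ioc_self hq'))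
        (mul_pos (H.rate_pos q hq') (H.pos q (Ioo_subset_Ioc_self hq')))).le

theorem flux_le_of_weight_le {δ : ℝ} (H : IsGrowingSolution p k a e φ φ₁) (hx : 0 < x)
    (hax : a < e - x) (hδ : ∀ r ∈ Ioo (e - x) (e - x / 2), p r ≤ δ) :
    p (e - x) * φ₁ (e - x) ≤ φ e * (2 * δ / x) := by
  have hmem : ∀ r ∈ Icc (e - x) (e - x / 2), r ∈ Ioc a e := fun r hr =>
    ⟨hax.trans_le hr.1, hr.2.trans (by linarith)⟩
  obtain ⟨t, ht⟩ : (Ioo (e - x) (e - x / 2)).Nonempty := nonempty_Ioo.2 (by linarith)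
  have hδpos : 0 < δ := (H.weight_pos t (hmem t (Ioo_subset_Icc_self ht))).trans_le (hδ t ht)
  have hsub := H.isFluxSolution.mono hax.le (by linarith : e - x / 2 ≤ e)
  have hincr : p (e - x) * φ₁ (e - x) / δ * (e - x / 2 - (e - x)) ≤ φ (e - x / 2) - φ (e - x) := by
    refine mul_sub_le_sub_of_le_deriv (by linarith) hsub.continuousOn
      (fun r => hsub.hasDerivAt) fun r hr => ?_
    have hr' := hmem r (Ioo_subset_Icc_self hr)
    rw [div_le_iff₀' hδpos]
    exact (H.monotoneOn_flux ⟨hax.le, by linarith⟩ (Ioc_subset_Icc_self hr') hr.1.le).trans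
      (mul_le_mul_of_nonneg_right (hδ r hr) (H.deriv_pos hr').le)
  have hle : φ (e - x / 2) ≤ φ e :=
    H.monotoneOn ⟨by linarith, by linarith⟩ ⟨by linarith, le_rfl⟩ (by linarith)
  have hpos := H.pos (e - x) ⟨hax, by linarith⟩
  calc p (e - x) * φ₁ (e - x)
      = p (e - x) * φ₁ (e - x) / δ * (e - x / 2 - (e - x)) * (2 * δ / x) := by
        field_simp
        ring
    _ ≤ φ e * (2 * δ / x) := mul_le_mul_of_nonneg_right (by linarith) (by positivity)

theorem flux_le_of_small_weight {P K δ : ℝ} (H : IsGrowingSolution p k a e φ φ₁) (hx : 0 < x)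
    (hax : a < e - x) (hK : ∀ r ∈ Ioo a e, k r ≤ K) (hP : ∀ r ∈ Ioo (e - x) e, p r ≤ P)
    (hδ : ∀ r ∈ Ioo (e - x) (e - x / 2), p r ≤ δ) :
    p e * φ₁ e ≤ φ e * (2 * δ / x + P * K * x) := by
  have hsub := H.isFluxSolution.mono hax.le le_rfl
  have hincr : p e * φ₁ e - p (e - x) * φ₁ (e - x) ≤ P * (K * φ e) * (e - (e - x)) := by
    refine sub_le_mul_sub_of_deriv_le (by linarith)
      (hsub.continuousOn_flux (H.continuousOn_weight.mono (Icc_subset_Icc_left hax.le)))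
      hsub.hasDerivAt_flux fun r hr => ?_
    have hr' : r ∈ Ioo a e := ⟨hax.trans hr.1, hr.2⟩
    have hp := H.weight_pos r (Ioo_subset_Ioc_self hr')
    have hk := H.rate_pos r hr'
    have hφ := H.pos r (Ioo_subset_Ioc_self hr')
    have hφe : φ r ≤ φ e :=
      H.monotoneOn (Ioo_subset_Icc_self hr') ⟨(hr'.1.trans hr'.2).le, le_rfl⟩ hr.2.le
    exact mul_le_mul (hP r hr) (mul_le_mul (hK r hr') hφe hφ.le (hk.le.trans (hK r hr')))
      (mul_pos hk hφ).le (hp.le.trans (hP r hr))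
  linarith [H.flux_le_of_weight_le hx hax hδ]

theorem le_flux_of_large_weight {w D κ : ℝ} (H : IsGrowingSolution p k a e φ φ₁) (hx : 0 < x)
    (hax : a < e - x) (hκ : 0 < κ) (hk : ∀ r ∈ Ioo a e, κ ≤ k r) (hw : 0 < w)
    (hwp : ∀ r ∈ Ioo (e - x) e, w ≤ p r) (hD : 0 < D)
    (hDp : ∀ r ∈ Ioo (e - x) (e - x / 2), D ≤ p r) :
    φ e ≤ p e * φ₁ e * (x / w + 2 / (D * κ * x)) := by
  have hleft : e - x ∈ Ioc a e := ⟨hax, by linarith⟩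
  have hmid : e - x / 2 ∈ Icc a e := ⟨by linarith, by linarith⟩
  have hright : e ∈ Icc a e := ⟨by linarith, le_rfl⟩
  have hflux : D * (κ * φ (e - x)) * (e - x / 2 - (e - x)) ≤
      p (e - x / 2) * φ₁ (e - x / 2) - p (e - x) * φ₁ (e - x) := by
    have hsub := H.isFluxSolution.mono hax.le hmid.2
    refine mul_sub_le_sub_of_le_deriv (by linarith)
      (hsub.continuousOn_flux (H.continuousOn_weight.mono (Icc_subset_Icc hax.le hmid.2)))
      hsub.hasDerivAt_flux fun r hr => ?_
    have hr' : r ∈ Ioo a e := ⟨hax.trans hr.1, hr.2.trans_le hmid.2⟩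
    have hφr := H.monotoneOn (Ioc_subset_Icc_self hleft) (Ioo_subset_Icc_self hr') hr.1.le
    exact mul_le_mul (hDp r hr) (mul_le_mul (hk r hr') hφr (H.pos _ hleft).le
      (H.rate_pos r hr').le) (mul_pos hκ (H.pos _ hleft)).le
      (H.weight_pos r (Ioo_subset_Ioc_self hr')).le
  have hφ : φ e - φ (e - x) ≤ p e * φ₁ e / w * (e - (e - x)) := by
    have hsub := H.isFluxSolution.mono hax.le le_rfl
    refine sub_le_mul_sub_of_deriv_le (by linarith) hsub.continuousOn
      (fun r => hsub.hasDerivAt) fun r hr => ?_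
    have hr' : r ∈ Ioc a e := ⟨hax.trans hr.1, hr.2.le⟩
    rw [le_div_iff₀' hw]
    exact (mul_le_mul_of_nonneg_right (hwp r hr) (H.deriv_pos hr').le).trans
      (H.monotoneOn_flux (Ioc_subset_Icc_self hr') hright hr.2.le)
  have hfluxe : p (e - x / 2) * φ₁ (e - x / 2) ≤ p e * φ₁ e :=
    H.monotoneOn_flux hmid hright hmid.2
  have hfluxx := mul_pos (H.weight_pos _ hleft) (H.deriv_pos hleft)
  have hφx : φ (e - x) ≤ p e * φ₁ e * (2 / (D * κ * x)) := by
    rw [← mul_div_assoc, le_div_iff₀ (by positivity)]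
    linarith
  linarith [show p e * φ₁ e / w * (e - (e - x)) = p e * φ₁ e * (x / w) by ring]

end IsGrowingSolution

section PeakWeights

variable {w k m φ φ₁ : ℝ → ℝ} {a e x : ℝ}

theorem IsPeakScale.inv_le_exp (h : IsPeakScale m x) (hx : 0 < x) {t : ℝ}
    (ht : t ∈ Icc (x / 2) x) : (4 * x ^ 2)⁻¹ ≤ Real.exp (2 * (x ^ 4)⁻¹ * m t) :=
  calc (4 * x ^ 2)⁻¹ = 2 * (x ^ 4)⁻¹ * (x ^ 2 / 8) := by field
    _ ≤ 2 * (x ^ 4)⁻¹ * m t := mul_le_mul_of_nonneg_left (h.peak_le t ht) (by positivity)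
    _ ≤ Real.exp (2 * (x ^ 4)⁻¹ * m t) := by linarith [Real.add_one_le_exp (2 * (x ^ 4)⁻¹ * m t)]

theorem IsPeakScale.exp_neg_two_le (h : IsPeakScale m x) (hx : 0 < x) {t : ℝ}
    (ht : t ∈ Icc 0 x) : Real.exp (-2) ≤ Real.exp (2 * (x ^ 4)⁻¹ * m t) := by
  refine Real.exp_le_exp.2 (le_trans (le_of_eq ?_)
    (mul_le_mul_of_nonneg_left (h.neg_le t ht) (by positivity)))
  field

theorem IsGrowingSolution.deriv_le_of_negative_peak {w₀ W K : ℝ}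
    (H : IsGrowingSolution (fun r => w r * Real.exp (2 * (x ^ 4)⁻¹ * m r)) k a e φ φ₁)
    (hx : 0 < x) (hax : a < e - x) (hm : m e = 0) (hpeak : IsPeakScale (fun t => -m (e - t)) x)
    (hK : ∀ r ∈ Ioo a e, k r ≤ K) (hw₀ : 0 < w₀) (hw : ∀ r ∈ Icc (e - x) e, w r ∈ Icc w₀ W) :
    φ₁ e ≤ φ e * (W / w₀ * (8 + Real.exp 2 * K) * x) := by
  have hexp (r : ℝ) : Real.exp (2 * (x ^ 4)⁻¹ * m r) =
      (Real.exp (2 * (x ^ 4)⁻¹ * -m (e - (e - r))))⁻¹ := by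
    rw [← Real.exp_neg, sub_sub_cancel, mul_neg, neg_neg]
  have he : e ∈ Icc (e - x) e := ⟨by linarith, le_rfl⟩
  have hW : 0 ≤ W := hw₀.le.trans ((hw e he).1.trans (hw e he).2)
  have h := H.flux_le_of_small_weight (P := W * Real.exp 2) (δ := W * (4 * x ^ 2)) hx hax hK
    (fun r hr => mul_le_mul (hw r (Ioo_subset_Icc_self hr)).2 ?_ (Real.exp_pos _).le hW)
    fun r hr => ?_
  · rw [hm, mul_zero, Real.exp_zero, mul_one] at h
    have hφ₁ := H.deriv_pos ⟨by linarith, le_rfl⟩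
    rw [← mul_le_mul_iff_right₀ hw₀]
    refine ((mul_le_mul_of_nonneg_right (hw e he).1 hφ₁.le).trans h).trans_eq ?_
    field
  · rw [hexp, inv_le_comm₀ (Real.exp_pos _) (Real.exp_pos _), ← Real.exp_neg]
    exact hpeak.exp_neg_two_le hx ⟨by linarith [hr.2], by linarith [hr.1]⟩
  · refine mul_le_mul (hw r ⟨hr.1.le, by linarith [hr.2]⟩).2 ?_ (Real.exp_pos _).le hW
    rw [hexp, inv_le_comm₀ (Real.exp_pos _) (by positivity)]
    exact hpeak.inv_le_exp hx ⟨by linarith [hr.2], by linarith [hr.1]⟩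

theorem IsGrowingSolution.le_deriv_of_positive_peak {w₀ W κ : ℝ}
    (H : IsGrowingSolution (fun r => w r * Real.exp (2 * (x ^ 4)⁻¹ * m r)) k a e φ φ₁)
    (hx : 0 < x) (hax : a < e - x) (hm : m e = 0) (hpeak : IsPeakScale (fun t => m (e - t)) x)
    (hκ : 0 < κ) (hk : ∀ r ∈ Ioo a e, κ ≤ k r) (hw₀ : 0 < w₀)
    (hw : ∀ r ∈ Icc (e - x) e, w r ∈ Icc w₀ W) :
    φ e ≤ φ₁ e * (W / w₀ * (Real.exp 2 + 8 / κ) * x) := by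
  have hexp (r : ℝ) : Real.exp (2 * (x ^ 4)⁻¹ * m r) =
      Real.exp (2 * (x ^ 4)⁻¹ * m (e - (e - r))) := by
    rw [sub_sub_cancel]
  have h := H.le_flux_of_large_weight (w := w₀ * Real.exp (-2)) (D := w₀ * (4 * x ^ 2)⁻¹) hx hax
    hκ hk (by positivity) (fun r hr => ?_) (by positivity) fun r hr => ?_
  · rw [hm, mul_zero, Real.exp_zero, mul_one] at h
    have hφ₁ := H.deriv_pos ⟨by linarith, le_rfl⟩
    have hW := mul_le_mul_of_nonneg_right (hw e ⟨by linarith, le_rfl⟩).2 hφ₁.le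
    refine (h.trans (mul_le_mul_of_nonneg_right hW (by positivity))).trans_eq ?_
    rw [Real.exp_neg]
    field
  · have hw_le := (hw r (Ioo_subset_Icc_self hr)).1
    rw [hexp]
    exact mul_le_mul hw_le
      (hpeak.exp_neg_two_le hx ⟨by linarith [hr.2], by linarith [hr.1]⟩) (Real.exp_pos _).le
      (hw₀.le.trans hw_le)
  · have hw_le := (hw r ⟨hr.1.le, by linarith [hr.2]⟩).1
    rw [hexp]
    exact mul_le_mul hw_le
      (hpeak.inv_le_exp hx ⟨by linarith [hr.2], by linarith [hr.1]⟩) (by positivity)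
      (hw₀.le.trans hw_le)

end PeakWeights

theorem exists_pos_forall_add_mul_pos {X : Type*} [TopologicalSpace X] {K : Set X}
    (hK : IsCompact K) {f g : X → ℝ} (hf : ContinuousOn f K) (hg : ContinuousOn g K)
    (hf_nonneg : ∀ x ∈ K, 0 ≤ f x) (hg_pos : ∀ x ∈ K, f x = 0 → 0 < g x) :
    ∃ τ > 0, ∀ x ∈ K, 0 < f x + τ * g x := by
  obtain ⟨δ, hδ, hmax⟩ := hK.exists_forall_le' (hf.sup hg) (a := 0) fun x hx =>
    lt_sup_iff.2 ((hf_nonneg x hx).lt_or_eq.imp_right fun h => hg_pos x hx h.symm)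
  obtain ⟨M, hM⟩ := hK.exists_bound_of_continuousOn hg
  have hτ : 0 < δ / (|M| + 1) := by positivity
  refine ⟨δ / (|M| + 1), hτ, fun x hx => ?_⟩
  rcases le_sup_iff.1 (hmax x hx) with h | h
  · have hτM : δ / (|M| + 1) * |M| < δ := by
      rw [div_mul_eq_mul_div, div_lt_iff₀ (by positivity)]
      linarith
    have hgM : -|M| ≤ g x := (abs_le.1 ((hM x hx).trans (le_abs_self M))).1
    linarith [mul_le_mul_of_nonneg_left hgM hτ.le]
  · exact add_pos_of_nonneg_of_pos (hf_nonneg x hx) (mul_pos hτ (hδ.trans_le h))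

namespace IsFluxSolution

variable {p c ψ ψ₁ : ℝ → ℝ} {a b ν ε : ℝ}

theorem exists_dirichlet_barrier (Hψ : IsFluxSolution p (fun r => (c r - ν) * ψ r) a b ψ ψ₁)
    (hc : ContinuousOn c (Icc a b)) (hab : a < b) (hψ : ∀ r ∈ Ioo a b, 0 < ψ r)
    (hca : ν < c a) (hcb : ν < c b) (hε : 0 < ε) :
    ∃ τ > 0, ∀ r ∈ Icc a b, 0 < ε * ψ r + τ * (c r - ν) := by
  refine exists_pos_forall_add_mul_pos isCompact_Icc (continuousOn_const.mul Hψ.continuousOn)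
    (hc.sub continuousOn_const)
    (fun r hr => mul_nonneg hε.le (nonneg_on_Icc_of_pos_on_Ioo hab Hψ.continuousOn hψ hr))
    fun r hr h0 => ?_
  rcases hr.1.eq_or_lt with rfl | har
  · exact sub_pos.2 hca
  rcases hr.2.eq_or_lt with rfl | hrb
  · exact sub_pos.2 hcb
  · exact absurd h0 (mul_pos hε (hψ r ⟨har, hrb⟩)).ne'

theorem exists_dirichlet_sub_le (Hψ : IsFluxSolution p (fun r => (c r - ν) * ψ r) a b ψ ψ₁)
    (hc : ContinuousOn c (Icc a b)) (hab : a < b) (hp : ContinuousOn p (Icc a b))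
    (hppos : ∀ r ∈ Ioo a b, 0 < p r) (hψ : ∀ r ∈ Ioo a b, 0 < ψ r) (hψa : ψ a = 0)
    (hψb : ψ b = 0) (hca : ν < c a) (hcb : ν < c b) (hε : 0 < ε) :
    ∃ η > 0, ∀ {μ : ℝ} {φ φ₁ : ℝ → ℝ}, IsFluxSolution p (fun r => (c r - μ) * φ r) a b φ φ₁ →
      (∀ r ∈ Icc a b, 0 < φ r) → φ a ≤ η * φ₁ a → φ b ≤ η * -φ₁ b → ν - ε ≤ μ := by
  obtain ⟨τ, hτ, hbarrier⟩ := Hψ.exists_dirichlet_barrier hc hab hψ hca hcb hε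
  obtain ⟨η, hη, hηa, hηb⟩ : ∃ η > 0, η * |ψ₁ a| ≤ τ ∧ η * |ψ₁ b| ≤ τ := by
    refine ⟨τ / (|ψ₁ a| + |ψ₁ b| + 1), by positivity, ?_, ?_⟩ <;>
      rw [div_mul_eq_mul_div, div_le_iff₀ (by positivity)] <;>
      exact mul_le_mul_of_nonneg_left (by linarith [abs_nonneg (ψ₁ a), abs_nonneg (ψ₁ b)]) hτ.le
  refine ⟨η, hη, fun {μ φ φ₁} H hφ hφa hφb => ?_⟩
  by_contra! hμ
  have hW := H.wronskian_lt (Hψ.add (const τ)) hab hp hppos fun r hr => by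
    have hrate : 0 < (ν - μ) * ψ r + τ * (c r - μ) := by
      nlinarith [hbarrier r (Ioo_subset_Icc_self hr), mul_pos (sub_pos.2 hμ) (hψ r hr)]
    nlinarith [mul_pos (hφ r (Ioo_subset_Icc_self hr)) hrate]
  have hend {x y z : ℝ} (hx : 0 < x) (hxy : x ≤ η * y) (hz : η * |z| ≤ τ) : x * z ≤ τ * y :=
    calc x * z ≤ x * |z| := mul_le_mul_of_nonneg_left (le_abs_self z) hx.le
      _ ≤ η * y * |z| := mul_le_mul_of_nonneg_right hxy (abs_nonneg z)
      _ = η * |z| * y := by ring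
      _ ≤ τ * y := mul_le_mul_of_nonneg_right hz (pos_of_mul_pos_right (hx.trans_le hxy) hη.le).le
  have hWa := mul_nonneg
    (nonneg_on_Icc_of_pos_on_Ioo hab hp hppos (left_mem_Icc.2 hab.le))
    (sub_nonneg.2 (hend (hφ a (left_mem_Icc.2 hab.le)) hφa hηa))
  have hWb := mul_nonneg
    (nonneg_on_Icc_of_pos_on_Ioo hab hp hppos (right_mem_Icc.2 hab.le))
    (sub_nonneg.2 (hend (hφ b (right_mem_Icc.2 hab.le)) hφb ((abs_neg (ψ₁ b)).symm ▸ hηb)))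
  simp only [wronskian, hψa, hψb] at hW
  linarith

theorem parabola {ρ : ℝ → ℝ} (hp : ∀ r ∈ Ioo a b, HasDerivAt p (ρ r * p r) r) :
    IsFluxSolution p (fun r => ρ r * (a + b - 2 * r) - 2) a b
      (fun r => (r - a) * (b - r)) (fun r => a + b - 2 * r) where
  hasDerivWithinAt r _ := ((((hasDerivAt_id r).sub_const a).mul
    ((hasDerivAt_id r).const_sub b)).congr_deriv (by simp only [id]; ring)).hasDerivWithinAt
  continuousOn_deriv := by fun_prop
  hasDerivAt_flux r hr := ((hp r hr).mul
    (((hasDerivAt_id r).const_mul 2).const_sub (a + b))).congr_deriv (by simp only [id]; ring)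

theorem exists_le_neumann_add {ρ : ℝ → ℝ}
    (Hψ : IsFluxSolution p (fun r => (c r - ν) * ψ r) a b ψ ψ₁)
    (hc : ContinuousOn c (Icc a b)) (hab : a < b) (hp : ContinuousOn p (Icc a b))
    (hppos : ∀ r ∈ Ioo a b, 0 < p r) (hp' : ∀ r ∈ Ioo a b, HasDerivAt p (ρ r * p r) r)
    (hρ : ContinuousOn ρ (Icc a b)) (hψ : ∀ r ∈ Icc a b, 0 < ψ r) (hψa : ψ₁ a = 0)
    (hψb : ψ₁ b = 0) (hε : 0 < ε) :
    ∃ η > 0, ∀ {μ : ℝ} {φ φ₁ : ℝ → ℝ}, IsFluxSolution p (fun r => (c r - μ) * φ r) a b φ φ₁ →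
      (∀ r ∈ Icc a b, 0 < φ r) → φ₁ a ≤ η * φ a → -φ₁ b ≤ η * φ b → μ ≤ ν + ε := by
  have ha := left_mem_Icc.2 hab.le
  have hb := right_mem_Icc.2 hab.le
  obtain ⟨τ, hτ, hbarrier⟩ := exists_pos_forall_add_mul_pos isCompact_Icc
    (f := fun r => ε * ψ r)
    (g := fun r => ρ r * (a + b - 2 * r) - 2 + (ν - c r) * ((r - a) * (b - r)))
    (continuousOn_const.mul Hψ.continuousOn) (by fun_prop)
    (fun r hr => (mul_pos hε (hψ r hr)).le) fun r hr h => absurd h (mul_pos hε (hψ r hr)).ne'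
  have hψab := add_pos (hψ a ha) (hψ b hb)
  obtain ⟨η, hη, hηa, hηb⟩ : ∃ η > 0, η * ψ a ≤ τ * (b - a) ∧ η * ψ b ≤ τ * (b - a) := by
    have hτab := mul_pos hτ (sub_pos.2 hab)
    refine ⟨τ * (b - a) / (ψ a + ψ b), div_pos hτab hψab, ?_, ?_⟩ <;>
      rw [div_mul_eq_mul_div, div_le_iff₀ hψab] <;>
      exact mul_le_mul_of_nonneg_left (by linarith [hψ a ha, hψ b hb]) hτab.le
  refine ⟨η, hη, fun {μ φ φ₁} H hφ hφa hφb => ?_⟩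
  by_contra! hμ
  have hW := (Hψ.add ((parabola hp').const_mul τ)).wronskian_lt H hab hp hppos fun r hr => by
    have hr' := Ioo_subset_Icc_self hr
    have hq : 0 ≤ τ * ((r - a) * (b - r)) :=
      mul_nonneg hτ.le (mul_nonneg (sub_nonneg.2 hr'.1) (sub_nonneg.2 hr'.2))
    have hrate : 0 < (c r - ν) * ψ r + τ * (ρ r * (a + b - 2 * r) - 2) -
        (c r - μ) * (ψ r + τ * ((r - a) * (b - r))) := by
      linarith [hbarrier r hr', mul_pos (sub_pos.2 hμ) (hψ r hr'),
        mul_nonneg (sub_nonneg.2 hμ.le) hq, mul_nonneg hε.le hq]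
    linarith [mul_pos (hφ r hr') hrate]
  have hend {x y z : ℝ} (hx : 0 ≤ x) (hz : 0 ≤ z) (hy : y ≤ η * x)
      (hηz : η * z ≤ τ * (b - a)) : z * y ≤ τ * (b - a) * x := by
    linarith [mul_le_mul_of_nonneg_left hy hz, mul_le_mul_of_nonneg_right hηz hx]
  have hWa := mul_nonneg (nonneg_on_Icc_of_pos_on_Ioo hab hp hppos ha)
    (sub_nonneg.2 (hend (hφ a ha).le (hψ a ha).le hφa hηa))
  have hWb := mul_nonneg (nonneg_on_Icc_of_pos_on_Ioo hab hp hppos hb)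
    (sub_nonneg.2 (hend (hφ b hb).le (hψ b hb).le hφb hηb))
  simp only [wronskian, hψa, hψb] at hW
  linarith

end IsFluxSolution

/-- `m` is a drift potential on `[0, 1]` that is symmetric about `1/2` and exerts no drift on the
middle interval `[1/3, 2/3]`. -/
structure IsMiddleFlat (m : ℝ → ℝ) : Prop where
  differentiable : Differentiable ℝ m
  eq_zero : ∀ r ∈ Icc (1 / 3 : ℝ) (2 / 3), m r = 0
  one_sub : ∀ r, m (1 - r) = m r

/-- A positive solution of the ball problem with drift potential `m`, cut at `1/3` and `2/3`: a
driftless solution in the middle, and one growing towards it on either side. The solution on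
`[2/3, 1]` is reflected to `[0, 1/3]`, so that both outer parts look alike. -/
structure IsSplitEigenfunction (d : ℕ) (c m : ℝ → ℝ) (s μ : ℝ) (φ φ₁ : ℝ → ℝ) : Prop where
  pos : ∀ r ∈ Icc (1 / 3 : ℝ) (2 / 3), 0 < φ r
  middle : IsFluxSolution (radialWeight d 0) (fun r => (c r - μ) * φ r) (1 / 3) (2 / 3) φ φ₁
  left : IsGrowingSolution (fun r => r ^ (d - 1) * Real.exp (2 * s * m r)) (fun r => c r - μ)
    0 (1 / 3) φ φ₁
  right : IsGrowingSolution (fun r => (1 - r) ^ (d - 1) * Real.exp (2 * s * m r))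
    (fun r => c (1 - r) - μ) 0 (1 / 3) (fun r => φ (1 - r)) (fun r => -φ₁ (1 - r))

theorem isMiddleFlat_oscDrift : IsMiddleFlat oscDrift where
  differentiable := contDiff_oscDrift.differentiable one_ne_zero
  eq_zero _ := oscDrift_eq_zero
  one_sub := oscDrift_one_sub

section Splitting

variable {d : ℕ} {c m φ φ₁ : ℝ → ℝ} {s μ : ℝ}

theorem IsMiddleFlat.isFluxSolution_middle {g : ℝ → ℝ} (hm : IsMiddleFlat m)
    (H : IsFluxSolution (radialWeight d fun r => 2 * s * m r) g 0 1 φ φ₁) :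
    IsFluxSolution (radialWeight d 0) g (1 / 3) (2 / 3) φ φ₁ :=
  (H.mono (by norm_num) (by norm_num)).congr
    (fun r hr => by simp [radialWeight, hm.eq_zero r (Ioo_subset_Icc_self hr)]) fun _ _ => rfl

theorem IsMiddleFlat.isFluxSolution_right {g : ℝ → ℝ} (hm : IsMiddleFlat m)
    (H : IsFluxSolution (radialWeight d fun r => 2 * s * m r) g 0 1 φ φ₁) :
    IsFluxSolution (fun r => (1 - r) ^ (d - 1) * Real.exp (2 * s * m r)) (fun r => g (1 - r))
      0 (1 / 3) (fun r => φ (1 - r)) (fun r => -φ₁ (1 - r)) := by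
  have h := (H.reflect 1).mono (sub_self 1).le (by norm_num : (1 / 3 : ℝ) ≤ 1 - 0)
  simpa only [radialWeight, hm.one_sub] using h

theorem IsMiddleFlat.isSplitEigenfunction (hm : IsMiddleFlat m)
    (H : IsFluxSolution (radialWeight d fun r => 2 * s * m r) (fun r => (c r - μ) * φ r) 0 1 φ φ₁)
    (hφ : ∀ r ∈ Ioo (0 : ℝ) 1, 0 < φ r) (h0 : φ₁ 0 = 0) (h1 : φ₁ 1 = 0)
    (hμ : ∀ r ∈ Icc (0 : ℝ) (1 / 3) ∪ Icc (2 / 3) 1, μ < c r) :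
    IsSplitEigenfunction d c m s μ φ φ₁ := by
  have hm_cont := hm.differentiable.continuous
  refine ⟨fun r hr => hφ r ⟨by linarith [hr.1], by linarith [hr.2]⟩, hm.isFluxSolution_middle H,
    ⟨H.mono le_rfl (by norm_num), by fun_prop,
      fun r hr => mul_pos (pow_pos hr.1 _) (Real.exp_pos _), fun r hr => ?_,
      fun r hr => hφ r ⟨hr.1, by linarith [hr.2]⟩, h0⟩,
    ⟨hm.isFluxSolution_right H, by fun_prop, fun r hr => ?_, fun r hr => ?_,
      fun r hr => hφ _ ⟨by linarith [hr.2], by linarith [hr.1]⟩, by simp [h1]⟩⟩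
  · exact sub_pos.2 (hμ r (.inl (Ioo_subset_Icc_self hr)))
  · exact mul_pos (pow_pos (by linarith [hr.2]) _) (Real.exp_pos _)
  · exact sub_pos.2 (hμ _ (.inr ⟨by linarith [hr.2], by linarith [hr.1]⟩))

theorem IsPositiveEigenfunction.isFluxSolution_middle (hd : 1 ≤ d) {A B : BoundaryType}
    {ψ : ℝ → ℝ} (hψ : IsPositiveEigenfunction d (fun _ => 0) c (1 / 3) (2 / 3) A B μ ψ) :
    IsFluxSolution (radialWeight d 0) (fun r => (c r - μ) * ψ r) (1 / 3) (2 / 3) ψ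
      (derivWithin ψ (Icc (1 / 3) (2 / 3))) :=
  hψ.isFluxSolution (by norm_num) fun r hr =>
    hasDerivAt_radialWeight hd (by linarith [hr.1]) (hasDerivAt_const r 0)

theorem radialWeight_zero_pos_of_middle : ∀ r ∈ Ioo (1 / 3 : ℝ) (2 / 3), 0 < radialWeight d 0 r :=
  fun _ hr => radialWeight_pos (by linarith [hr.1])

theorem IsMiddleEigenvalue.lt_dirichlet {lamDD : ℝ} (hd : 1 ≤ d)
    (hDD : IsMiddleEigenvalue d c .dirichlet .dirichlet lamDD)
    (H : IsFluxSolution (radialWeight d 0) (fun r => (c r - μ) * φ r) (1 / 3) (2 / 3) φ φ₁)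
    (hφ : ∀ r ∈ Icc (1 / 3 : ℝ) (2 / 3), 0 < φ r) : μ < lamDD := by
  obtain ⟨ψ, hψ⟩ := hDD
  exact H.lt_dirichlet (hψ.isFluxSolution_middle hd) (by norm_num)
    (continuous_radialWeight continuous_zero).continuousOn radialWeight_zero_pos_of_middle hφ
    hψ.pos hψ.left hψ.right

theorem IsBallEigenvalue.exists_isSplitEigenfunction {lamDD : ℝ} (hd : 1 ≤ d)
    (hm : IsMiddleFlat m) (hDD : IsMiddleEigenvalue d c .dirichlet .dirichlet lamDD)
    (H1 : ∀ r ∈ Icc (0 : ℝ) (1 / 3) ∪ Icc (2 / 3) 1, lamDD < c r)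
    (hμ : IsBallEigenvalue d c m s μ) :
    μ < lamDD ∧ ∃ φ φ₁, IsSplitEigenfunction d c m s μ φ φ₁ := by
  obtain ⟨φ, hφ⟩ := hμ
  have H := hφ.isFluxSolution zero_lt_one fun r hr =>
    hasDerivAt_radialWeight hd hr.1 ((hm.differentiable r).hasDerivAt.const_mul (2 * s))
  have hlt : μ < lamDD := hDD.lt_dirichlet hd (hm.isFluxSolution_middle H)
    fun r hr => hφ.pos r ⟨by linarith [hr.1], by linarith [hr.2]⟩
  exact ⟨hlt, φ, _, hm.isSplitEigenfunction H hφ.pos hφ.left hφ.right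
    fun r hr => hlt.trans (H1 r hr)⟩

end Splitting

section PeakLimits

variable {d : ℕ} {c m : ℝ → ℝ} {lamDD lamNN : ℝ} {lam : ℝ → ℝ}

theorem pow_mem_Icc_of_sixth_le (n : ℕ) {t : ℝ} (ht : 1 / 6 ≤ t) (ht₁ : t ≤ 1) :
    t ^ n ∈ Icc ((1 / 6 : ℝ) ^ n) 1 :=
  ⟨pow_le_pow_left₀ (by norm_num) ht n, pow_le_one₀ (by linarith) ht₁⟩

theorem eventually_mul_le_nhdsGT_zero (C : ℝ) {η : ℝ} (hη : 0 < η) :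
    ∀ᶠ x in 𝓝[>] 0, C * x ≤ η :=
  nhdsWithin_le_nhds <| ((continuous_const_mul C).tendsto' 0 0 (mul_zero C)).eventually
    (Iic_mem_nhds hη)

namespace IsSplitEigenfunction

variable {φ φ₁ : ℝ → ℝ} {x μ : ℝ}

theorem le_deriv_of_positive_peak {κ : ℝ}
    (H : IsSplitEigenfunction d c m (x ^ 4)⁻¹ μ φ φ₁) (hm : IsMiddleFlat m)
    (hx : x ∈ Ioo (0 : ℝ) (1 / 6)) (hpeak : IsPeakScale (fun t => m (1 / 3 - t)) x) (hκ : 0 < κ)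
    (hc : ∀ r ∈ Icc (0 : ℝ) (1 / 3) ∪ Icc (2 / 3) 1, κ ≤ c r - μ) :
    φ (1 / 3) ≤ φ₁ (1 / 3) * (1 / (1 / 6) ^ (d - 1) * (Real.exp 2 + 8 / κ) * x) ∧
      φ (2 / 3) ≤ -φ₁ (2 / 3) * (1 / (1 / 6) ^ (d - 1) * (Real.exp 2 + 8 / κ) * x) := by
  obtain ⟨hx0, hx6⟩ := hx
  have hm₀ : m (1 / 3) = 0 := hm.eq_zero _ ⟨le_rfl, by norm_num⟩
  refine ⟨H.left.le_deriv_of_positive_peak hx0 (by linarith) hm₀ hpeak hκ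
    (fun r hr => hc r (.inl (Ioo_subset_Icc_self hr))) (by positivity)
    fun r hr => pow_mem_Icc_of_sixth_le _ (by linarith [hr.1]) (by linarith [hr.2]), ?_⟩
  have hright := H.right.le_deriv_of_positive_peak hx0 (by linarith) hm₀ hpeak hκ
    (fun r hr => hc _ (.inr ⟨by linarith [hr.2], by linarith [hr.1]⟩)) (by positivity)
    fun r hr => pow_mem_Icc_of_sixth_le (d - 1) (by linarith [hr.2]) (by linarith [hr.1])
  rwa [show (1 : ℝ) - 1 / 3 = 2 / 3 by norm_num] at hright

theorem deriv_le_of_negative_peak {K : ℝ}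
    (H : IsSplitEigenfunction d c m (x ^ 4)⁻¹ μ φ φ₁) (hm : IsMiddleFlat m)
    (hx : x ∈ Ioo (0 : ℝ) (1 / 6)) (hpeak : IsPeakScale (fun t => -m (1 / 3 - t)) x)
    (hc : ∀ r ∈ Icc (0 : ℝ) 1, c r - μ ≤ K) :
    φ₁ (1 / 3) ≤ φ (1 / 3) * (1 / (1 / 6) ^ (d - 1) * (8 + Real.exp 2 * K) * x) ∧
      -φ₁ (2 / 3) ≤ φ (2 / 3) * (1 / (1 / 6) ^ (d - 1) * (8 + Real.exp 2 * K) * x) := by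
  obtain ⟨hx0, hx6⟩ := hx
  have hm₀ : m (1 / 3) = 0 := hm.eq_zero _ ⟨le_rfl, by norm_num⟩
  refine ⟨H.left.deriv_le_of_negative_peak hx0 (by linarith) hm₀ hpeak
    (fun r hr => hc r ⟨hr.1.le, by linarith [hr.2]⟩) (by positivity)
    fun r hr => pow_mem_Icc_of_sixth_le _ (by linarith [hr.1]) (by linarith [hr.2]), ?_⟩
  have hright := H.right.deriv_le_of_negative_peak hx0 (by linarith) hm₀ hpeak
    (fun r hr => hc _ ⟨by linarith [hr.2], by linarith [hr.1]⟩) (by positivity)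
    fun r hr => pow_mem_Icc_of_sixth_le (d - 1) (by linarith [hr.2]) (by linarith [hr.1])
  rwa [show (1 : ℝ) - 1 / 3 = 2 / 3 by norm_num] at hright

theorem deriv_pos (H : IsSplitEigenfunction d c m x μ φ φ₁) :
    0 < φ₁ (1 / 3) ∧ 0 < -φ₁ (2 / 3) := by
  have hright := H.right.deriv_pos (right_mem_Ioc.2 (by norm_num))
  rw [show (1 : ℝ) - 1 / 3 = 2 / 3 by norm_num] at hright
  exact ⟨H.left.deriv_pos (right_mem_Ioc.2 (by norm_num)), hright⟩

theorem neumann_le {ψ : ℝ → ℝ} (H : IsSplitEigenfunction d c m x μ φ φ₁) (hd : 1 ≤ d)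
    (hψ : IsPositiveEigenfunction d (fun _ => 0) c (1 / 3) (2 / 3) .neumann .neumann lamNN ψ) :
    lamNN ≤ μ :=
  H.middle.neumann_le (hψ.isFluxSolution_middle hd) (by norm_num)
    (continuous_radialWeight continuous_zero).continuousOn radialWeight_zero_pos_of_middle
    (fun r hr => H.pos r (Ioo_subset_Icc_self hr)) hψ.pos H.deriv_pos.1.le
    (neg_pos.1 H.deriv_pos.2).le hψ.left hψ.right

end IsSplitEigenfunction

theorem tendsto_dirichlet_of_positive_peaks (hd : 1 ≤ d) (hc : ContinuousOn c (Icc 0 1))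
    (hm : IsMiddleFlat m) (hDD : IsMiddleEigenvalue d c .dirichlet .dirichlet lamDD)
    (H1 : ∀ r ∈ Icc (0 : ℝ) (1 / 3) ∪ Icc (2 / 3) 1, lamDD < c r)
    (hlam : ∀ s, IsBallEigenvalue d c m s (lam s)) :
    Tendsto (fun x => lam (x ^ 4)⁻¹)
      (𝓝[>] 0 ⊓ 𝓟 {x | IsPeakScale (fun t => m (1 / 3 - t)) x}) (𝓝 lamDD) := by
  have hsplit s := (hlam s).exists_isSplitEigenfunction hd hm hDD H1
  obtain ⟨ψ, hψ⟩ := hDD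
  obtain ⟨ℓ, hℓ, hgap⟩ := (isCompact_Icc.union isCompact_Icc).exists_forall_le'
    (hc.mono (union_subset (Icc_subset_Icc_right (by norm_num))
      (Icc_subset_Icc_left (by norm_num)))) H1
  refine tendsto_order.2 ⟨fun a ha => eventually_inf_principal.2 ?_,
    fun a ha => .of_forall fun x => (hsplit _).1.trans ha⟩
  obtain ⟨η, hη, hlow⟩ := (hψ.isFluxSolution_middle hd).exists_dirichlet_sub_le
    (hc.mono (Icc_subset_Icc (by norm_num) (by norm_num))) (by norm_num)
    (continuous_radialWeight continuous_zero).continuousOn radialWeight_zero_pos_of_middle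
    hψ.pos hψ.left hψ.right (H1 _ (.inl ⟨by norm_num, le_rfl⟩))
    (H1 _ (.inr ⟨le_rfl, by norm_num⟩)) (half_pos (sub_pos.2 ha))
  filter_upwards [Ioo_mem_nhdsGT (by norm_num : (0 : ℝ) < 1 / 6),
    eventually_mul_le_nhdsGT_zero
      (1 / (1 / 6) ^ (d - 1) * (Real.exp 2 + 8 / (ℓ - lamDD))) hη] with x hx hxη hpeak
  obtain ⟨hlt, φ, φ₁, H⟩ := hsplit (x ^ 4)⁻¹
  obtain ⟨hleft, hright⟩ := H.le_deriv_of_positive_peak hm hx hpeak (sub_pos.2 hℓ)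
    fun r hr => sub_le_sub (hgap r hr) hlt.le
  have hge := hlow H.middle H.pos
    (hleft.trans (mul_comm η _ ▸ mul_le_mul_of_nonneg_left hxη H.deriv_pos.1.le))
    (hright.trans (mul_comm η _ ▸ mul_le_mul_of_nonneg_left hxη H.deriv_pos.2.le))
  linarith

theorem tendsto_neumann_of_negative_peaks (hd : 1 ≤ d) (hc : ContinuousOn c (Icc 0 1))
    (hm : IsMiddleFlat m) (hDD : IsMiddleEigenvalue d c .dirichlet .dirichlet lamDD)
    (H1 : ∀ r ∈ Icc (0 : ℝ) (1 / 3) ∪ Icc (2 / 3) 1, lamDD < c r) {ψ : ℝ → ℝ}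
    (hψ : IsPositiveEigenfunction d (fun _ => 0) c (1 / 3) (2 / 3) .neumann .neumann lamNN ψ)
    (hψpos : ∀ r ∈ Icc (1 / 3 : ℝ) (2 / 3), 0 < ψ r)
    (hlam : ∀ s, IsBallEigenvalue d c m s (lam s)) :
    Tendsto (fun x => lam (x ^ 4)⁻¹)
      (𝓝[>] 0 ⊓ 𝓟 {x | IsPeakScale (fun t => -m (1 / 3 - t)) x}) (𝓝 lamNN) := by
  have hsplit s := ((hlam s).exists_isSplitEigenfunction hd hm hDD H1).2
  have hle s : lamNN ≤ lam s := let ⟨_, _, H⟩ := hsplit s; H.neumann_le hd hψ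
  obtain ⟨K, hK⟩ := isCompact_Icc.exists_bound_of_continuousOn hc
  refine tendsto_order.2 ⟨fun a ha => .of_forall fun x => ha.trans_le (hle _),
    fun a ha => eventually_inf_principal.2 ?_⟩
  have hpos : ∀ r ∈ Icc (1 / 3 : ℝ) (2 / 3), 0 < r := fun r hr => by linarith [hr.1]
  obtain ⟨η, hη, hup⟩ := (hψ.isFluxSolution_middle hd).exists_le_neumann_add
    (hc.mono (Icc_subset_Icc (by norm_num) (by norm_num))) (by norm_num)
    (continuous_radialWeight continuous_zero).continuousOn radialWeight_zero_pos_of_middle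
    (fun r hr => hasDerivAt_radialWeight hd (hpos r (Ioo_subset_Icc_self hr))
      (hasDerivAt_const r 0))
    ((continuousOn_const.div continuousOn_id fun r hr => (hpos r hr).ne').add continuousOn_const)
    hψpos hψ.left hψ.right (half_pos (sub_pos.2 ha))
  filter_upwards [Ioo_mem_nhdsGT (by norm_num : (0 : ℝ) < 1 / 6),
    eventually_mul_le_nhdsGT_zero
      (1 / (1 / 6) ^ (d - 1) * (8 + Real.exp 2 * (K - lamNN))) hη] with x hx hxη hpeak
  obtain ⟨φ, φ₁, H⟩ := hsplit (x ^ 4)⁻¹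
  obtain ⟨hleft, hright⟩ := H.deriv_le_of_negative_peak hm hx hpeak
    fun r hr => sub_le_sub ((le_abs_self _).trans (hK r hr)) (hle _)
  have hlt := hup H.middle H.pos
    (hleft.trans (mul_comm η _ ▸ mul_le_mul_of_nonneg_left hxη
      (H.pos _ ⟨le_rfl, by norm_num⟩).le))
    (hright.trans (mul_comm η _ ▸ mul_le_mul_of_nonneg_left hxη
      (H.pos _ ⟨by norm_num, le_rfl⟩).le))
  linarith

end PeakLimits

theorem exists_seq_tendsto_of_frequently {P : ℝ → Prop} {f : ℝ → ℝ} {L : ℝ}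
    (hP : ∃ᶠ x in 𝓝[>] 0, P x)
    (hf : Tendsto (fun x => f (x ^ 4)⁻¹) (𝓝[>] 0 ⊓ 𝓟 {x | P x}) (𝓝 L)) :
    ∃ s : ℕ → ℝ, Tendsto s atTop atTop ∧ Tendsto (fun n => f (s n)) atTop (𝓝 L) := by
  have : (𝓝[>] (0 : ℝ) ⊓ 𝓟 {x | P x}).NeBot := frequently_mem_iff_neBot.1 hP
  obtain ⟨x, hx⟩ := exists_seq_tendsto (𝓝[>] (0 : ℝ) ⊓ 𝓟 {x | P x})
  have hscale : Tendsto (fun x : ℝ => (x ^ 4)⁻¹) (𝓝[>] 0) atTop := by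
    simp only [← inv_pow]
    exact (tendsto_pow_atTop four_ne_zero).comp tendsto_inv_nhdsGT_zero
  exact ⟨fun n => (x n ^ 4)⁻¹, hscale.comp (hx.mono_right inf_le_left), hf.comp hx⟩

theorem theorem1p1 (d : ℕ) (hd : 1 ≤ d) (c : ℝ → ℝ) (hc : ContinuousOn c (Icc 0 1))
    (lamDD : ℝ) (hDD : IsMiddleEigenvalue d c .dirichlet .dirichlet lamDD)
    (H1 : ∀ r ∈ Icc (0 : ℝ) (1 / 3) ∪ Icc (2 / 3) 1, lamDD < c r) :
    ∃ lamNN : ℝ, (∀ μ : ℝ, IsMiddleEigenvalue d c .neumann .neumann μ ↔ μ = lamNN) ∧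
    ∃ m : ℝ → ℝ,
      ContDiffOn ℝ 1 m (Icc 0 1) ∧
      (∀ r ∈ Icc (1 / 3 : ℝ) (2 / 3), m r = 0) ∧
      (∀ r ∈ Icc (0 : ℝ) 1, m r = m (1 - r)) ∧
      OscillatesInfinitely m (𝓝[<] (1 / 3)) ∧
      OscillatesInfinitely m (𝓝[>] (2 / 3)) ∧
      ∃ lam : ℝ → ℝ,
        (∀ s μ : ℝ, IsBallEigenvalue d c m s μ ↔ μ = lam s) ∧
        (¬ ∃ L : ℝ, Tendsto lam atTop (𝓝 L)) ∧
        (∃ s : ℕ → ℝ, Tendsto s atTop atTop ∧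
          Tendsto (fun n => lam (s n)) atTop (𝓝 lamDD)) ∧
        (∃ s : ℕ → ℝ, Tendsto s atTop atTop ∧
          Tendsto (fun n => lam (s n)) atTop (𝓝 lamNN)) := by
  have hflat := isMiddleFlat_oscDrift
  have hball (s : ℝ) := exists_neumann_eigenvalue hd zero_lt_one le_rfl hc
    (fun r => (hflat.differentiable r).hasDerivAt.const_mul (2 * s))
    ((contDiff_oscDrift.continuous_deriv le_rfl).const_mul (2 * s))
  choose lam _ _ _ hlam using hball
  have hlam_self (s : ℝ) : IsBallEigenvalue d c oscDrift s (lam s) := (hlam s (lam s)).2 rfl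
  obtain ⟨lamNN, ψ, hψ, hψpos, hNN⟩ := exists_neumann_eigenvalue (v := fun _ => 0)
    (a := 1 / 3) (b := 2 / 3) hd (by norm_num) (by norm_num)
    (hc.mono (Icc_subset_Icc (by norm_num) (by norm_num))) (fun r => hasDerivAt_const r 0)
    continuous_const
  have hlt : lamNN < lamDD := hDD.lt_dirichlet hd (hψ.isFluxSolution_middle hd) hψpos
  obtain ⟨s, hs, hs_lim⟩ := exists_seq_tendsto_of_frequently frequently_isPeakScale_oscDrift
    (tendsto_dirichlet_of_positive_peaks hd hc hflat hDD H1 hlam_self)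
  obtain ⟨t, ht, ht_lim⟩ := exists_seq_tendsto_of_frequently frequently_isPeakScale_neg_oscDrift
    (tendsto_neumann_of_negative_peaks hd hc hflat hDD H1 hψ hψpos hlam_self)
  refine ⟨lamNN, hNN, oscDrift, contDiff_oscDrift.contDiffOn, hflat.eq_zero,
    fun r _ => (hflat.one_sub r).symm, oscillatesInfinitely_left, oscillatesInfinitely_right,
    lam, hlam, fun ⟨L, hL⟩ => hlt.ne ?_, ⟨s, hs, hs_lim⟩, ⟨t, ht, ht_lim⟩⟩
  exact (tendsto_nhds_unique ht_lim (hL.comp ht)).trans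
    (tendsto_nhds_unique (hL.comp hs) hs_lim)
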